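/- **Albert's cosymplectic reduction.** All manifolds are smooth, finite-dimensional, Hausdorff and second countable. A *cosymplectic structure* on a manifold $M$ is a pair $(\omega,\eta)$ of a smooth closed 2-form $\omega$ and a smooth closed 1-form $\eta$ such that at every point $x\in M$ one has $\eta_x\neq 0$, $\ker\omega_x\cap\ker\eta_x=\{0\}$ and $\dim\ker\omega_x=1$ (equivalently, $\dim M=2n+1$ and $\eta\wedge\omega^n$ is a volume form). Let $(M,\omega,\eta)$ be a cosymplectic manifold and let $G$ be a connected Lie group with Lie algebra $\mathfrak g$ that acts on $M$ smoothly, freely and properly; write $\Phi_g(x)=g\cdot x$, and let $\xi_M$ be the infinitesimal generator of $\xi\in\mathfrak g$. Suppose that the action is cosymplectic, i.e. $\Phi_g^*\omega=\omega$ for all $g\in G$ and $i_{\xi_M}\eta=0$ for all $\xi\in\mathfrak g$. Let $J\colon M\to\mathfrak g^*$ be a smooth momentum map, i.e. $i_{\xi_M}\omega=dJ_\xi$ for all $\xi\in\mathfrak g$, where $J_\xi(x)=\langle J(x),\xi\rangle$, and suppose that $J$ is equivariant: $J(g\cdot x)=\mathrm{Ad}^*_{g^{-1}}J(x)$. Let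 $\mu\in\mathfrak g^*$ be a regular value of $J$, let $G_\mu=\{g\in G:\mathrm{Ad}^*_{g^{-1}}\mu=\mu\}$ be its isotropy group, let $j_\mu\colon J^{-1}(\mu)\to M$ be the inclusion and let $\pi_\mu\colon J^{-1}(\mu)\to M_\mu=J^{-1}(\mu)/G_\mu$ be the projection. Then $J^{-1}(\mu)$ is an embedded submanifold of $M$, the quotient space $M_\mu$ (with the quotient topology) is a manifold for which $\pi_\mu$ is a submersion, and there are unique differential forms $\omega_\mu$ and $\eta_\mu$ on $M_\mu$ with $$\pi_\mu^*\omega_\mu=j_\mu^*\omega,\qquad \pi_\mu^*\eta_\mu=j_\mu^*\eta;$$ moreover $(\omega_\mu,\eta_\mu)$ is a cosymplectic structure on $M_\mu$. -/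

import Mathlib

open scoped Manifold ContDiff Topology

noncomputable section

namespace CosymplecticReduction

/-! ### Differential forms on a boundaryless manifold -/

section Forms

variable {E E' : Type*} [NormedAddCommGroup E] [NormedSpace ℝ E]
  [NormedAddCommGroup E'] [NormedSpace ℝ E']

/-- A (not necessarily smooth) differential `k`-form on a manifold `M` modelled on `E`: an
alternating `k`-linear form on each tangent space. -/
abbrev DiffForm (E : Type*) [NormedAddCommGroup E] [NormedSpace ℝ E]
    (M : Type*) [TopologicalSpace M] [ChartedSpace E M] (k : ℕ) :=
  (x : M) → TangentSpace 𝓘(ℝ, E) x [⋀^Fin k]→L[ℝ] ℝ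

variable {M : Type*} [TopologicalSpace M] [ChartedSpace E M]
  {N : Type*} [TopologicalSpace N] [ChartedSpace E' N] {k : ℕ}

/-- The pullback `f^* α`, that is `(f^* α)_x (v₁, …, vₖ) = α_{f x} (Tₓf v₁, …, Tₓf vₖ)`. -/
def DiffForm.pullback (f : M → N) (α : DiffForm E' N k) : DiffForm E M k :=
  fun x => (α (f x)).compContinuousLinearMap (mfderiv 𝓘(ℝ, E) 𝓘(ℝ, E') f x)

/-- The coordinate expression of a form in the chart at `x₀`: its pullback under the inverse of
the chart, which is meaningful on the target of the chart, an open subset of `E`. -/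
def DiffForm.inChart (α : DiffForm E M k) (x₀ : M) : E → E [⋀^Fin k]→L[ℝ] ℝ :=
  DiffForm.pullback (E := E) (E' := E) (M := E) (extChartAt 𝓘(ℝ, E) x₀).symm α

/-- A form is smooth if all its coordinate expressions are. -/
def DiffForm.IsSmooth (α : DiffForm E M k) : Prop :=
  ∀ x₀ : M, ContDiffOn ℝ ∞ (α.inChart x₀) (extChartAt 𝓘(ℝ, E) x₀).target

/-- A form is closed if the exterior derivatives of all its coordinate expressions vanish. -/
def DiffForm.IsClosed (α : DiffForm E M k) : Prop :=
  ∀ x₀ : M, ∀ y ∈ (extChartAt 𝓘(ℝ, E) x₀).target, extDeriv (α.inChart x₀) y = 0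

/-- The kernel `{v | i_v α = 0}` of an alternating form. -/
def formKer {V : Type*} [AddCommGroup V] [Module ℝ V] [TopologicalSpace V] {k : ℕ}
    (α : V [⋀^Fin (k + 1)]→L[ℝ] ℝ) : Submodule ℝ V where
  carrier := {v | ∀ w : Fin k → V, α (Matrix.vecCons v w) = 0}
  zero_mem' := fun w => α.map_coord_zero 0 rfl
  add_mem' := fun {v v'} hv hv' w => by
    rw [ContinuousAlternatingMap.vecCons_add, hv, hv', add_zero]
  smul_mem' := fun c v hv w => by
    rw [ContinuousAlternatingMap.vecCons_smul, hv, smul_zero]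

/-- A cosymplectic structure `(Ω, η)` on `M`: a smooth closed 2-form and a smooth closed 1-form
such that at each point `η ≠ 0`, `ker Ω ∩ ker η = 0` and `dim ker Ω = 1`. (These are the
conditions on a `k`-polycosymplectic structure for `k = 1`. On a finite-dimensional manifold they
say that `dim M = 2n + 1` and that `η ∧ Ωⁿ` is a volume form.) -/
structure IsCosymplectic (Ω : DiffForm E M 2) (η : DiffForm E M 1) : Prop where
  smooth_two : Ω.IsSmooth
  smooth_one : η.IsSmooth
  closed_two : Ω.IsClosed
  closed_one : η.IsClosed
  ne_zero : ∀ x, η x ≠ 0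
  ker_inf_ker : ∀ x, formKer (Ω x) ⊓ formKer (η x) = ⊥
  finrank_ker : ∀ x, Module.finrank ℝ (formKer (Ω x)) = 1

end Forms

/-! ### Lie group actions and momentum maps

The Lie algebra of a Lie group `G` modelled on `F` is the tangent space at `1`, whose underlying
normed space is `F`; its dual is `F →L[ℝ] ℝ`. -/

section Action

variable {F : Type*} [NormedAddCommGroup F] [NormedSpace ℝ F]
  {G : Type*} [TopologicalSpace G] [ChartedSpace F G] [Group G]

/-- The adjoint action `Ad_g` on the Lie algebra, the derivative at `1` of `h ↦ g h g⁻¹`. -/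
def Ad (F : Type*) [NormedAddCommGroup F] [NormedSpace ℝ F]
    {G : Type*} [TopologicalSpace G] [ChartedSpace F G] [Group G] (g : G) : F →L[ℝ] F :=
  mfderiv 𝓘(ℝ, F) 𝓘(ℝ, F) (fun h : G => g * h * g⁻¹) 1

/-- The coadjoint action `Coad_g μ = Ad^*_{g⁻¹} μ` on the dual of the Lie algebra. -/
def Coad (g : G) (μ : F →L[ℝ] ℝ) : F →L[ℝ] ℝ := μ.comp (Ad F g⁻¹)

lemma Ad_one : Ad F (1 : G) = ContinuousLinearMap.id ℝ F := by
  have : (fun h : G => 1 * h * 1⁻¹) = id := by ext; simp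
  unfold Ad
  rw [this]
  exact mfderiv_id

lemma Ad_mul [LieGroup 𝓘(ℝ, F) ∞ G] (g h : G) : Ad F (g * h) = (Ad F g).comp (Ad F h) := by
  have hd : ∀ a b : G, MDifferentiableAt 𝓘(ℝ, F) 𝓘(ℝ, F) (fun h : G => a * h * a⁻¹) b := by
    intro a b
    have : ContMDiff 𝓘(ℝ, F) 𝓘(ℝ, F) ∞ (fun h : G => a * h * a⁻¹) :=
      (contMDiff_const.mul contMDiff_id).mul contMDiff_const
    exact this.mdifferentiableAt (by simp)
  have hc : (fun k : G => g * h * k * (g * h)⁻¹)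
      = (fun k : G => g * k * g⁻¹) ∘ (fun k : G => h * k * h⁻¹) := by
    ext k; simp [mul_assoc]
  have e := mfderiv_comp (1 : G) (hd g (h * 1 * h⁻¹)) (hd h 1)
  rw [← hc] at e
  have h1 : h * 1 * h⁻¹ = 1 := by simp
  unfold Ad
  rw [e]
  change ContinuousLinearMap.comp (mfderiv 𝓘(ℝ, F) 𝓘(ℝ, F) (fun k : G => g * k * g⁻¹)
    (h * 1 * h⁻¹) : F →L[ℝ] F) _ = _
  rw [h1]
  rfl

/-- The isotropy group `G_μ` of `μ` under the coadjoint action. -/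
def isotropy (G : Type*) {F : Type*} [NormedAddCommGroup F] [NormedSpace ℝ F]
    [TopologicalSpace G] [ChartedSpace F G] [Group G] [LieGroup 𝓘(ℝ, F) ∞ G]
    (μ : F →L[ℝ] ℝ) : Subgroup G where
  carrier := {g | Coad g μ = μ}
  one_mem' := by simp [Coad, Ad_one]
  mul_mem' := fun {a b} ha hb => by
    change μ.comp (Ad F a⁻¹) = μ at ha
    change μ.comp (Ad F b⁻¹) = μ at hb
    change μ.comp (Ad F (a * b)⁻¹) = μ
    rw [mul_inv_rev, Ad_mul, ← ContinuousLinearMap.comp_assoc, hb, ha]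
  inv_mem' := fun {a} ha => by
    change μ.comp (Ad F a⁻¹) = μ at ha
    change μ.comp (Ad F a⁻¹⁻¹) = μ
    conv_lhs => rw [← ha]
    rw [ContinuousLinearMap.comp_assoc, ← Ad_mul, inv_inv, inv_mul_cancel, Ad_one,
      ContinuousLinearMap.comp_id]

variable {E : Type*} [NormedAddCommGroup E] [NormedSpace ℝ E]
  {M : Type*} [TopologicalSpace M] [ChartedSpace E M] [MulAction G M]

/-- The infinitesimal generator `ξ_M(x) = d/dt|_{t = 0} exp(tξ) • x`, that is, the image of `ξ`
under the derivative at `1` of the orbit map `g ↦ g • x`. -/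
def infGen (E : Type*) [NormedAddCommGroup E] [NormedSpace ℝ E]
    {F : Type*} [NormedAddCommGroup F] [NormedSpace ℝ F]
    (G : Type*) [TopologicalSpace G] [ChartedSpace F G] [Group G]
    {M : Type*} [TopologicalSpace M] [ChartedSpace E M] [MulAction G M]
    (ξ : F) (x : M) : TangentSpace 𝓘(ℝ, E) x :=
  (mfderiv 𝓘(ℝ, F) 𝓘(ℝ, E) (fun g : G => g • x) 1 : F →L[ℝ] E) ξ

/-- The action of `G` is cosymplectic: `Φ_g^* Ω = Ω` for all `g`, and `i_{ξ_M} η = 0` for all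
elements `ξ` of the Lie algebra. -/
structure IsCosymplecticAction (F : Type*) [NormedAddCommGroup F] [NormedSpace ℝ F]
    (G : Type*) [TopologicalSpace G] [ChartedSpace F G] [Group G] [MulAction G M]
    (Ω : DiffForm E M 2) (η : DiffForm E M 1) : Prop where
  pullback_two : ∀ g : G, DiffForm.pullback (fun x : M => g • x) Ω = Ω
  infGen_one : ∀ (ξ : F) (x : M), η x ![infGen E G ξ x] = 0

/-- `J : M → 𝔤^*` is a (smooth, coadjoint equivariant) momentum map:
`i_{ξ_M} Ω = dJ_ξ` with `J_ξ(x) = ⟨J(x), ξ⟩`, and `J(g • x) = Ad^*_{g⁻¹} J(x)`. -/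
structure IsMomentumMap (G : Type*) [TopologicalSpace G] [ChartedSpace F G] [Group G]
    [MulAction G M] (Ω : DiffForm E M 2) (J : M → F →L[ℝ] ℝ) : Prop where
  smooth : ContMDiff 𝓘(ℝ, E) 𝓘(ℝ, F →L[ℝ] ℝ) ∞ J
  moment : ∀ (ξ : F) (x : M) (v : TangentSpace 𝓘(ℝ, E) x),
    Ω x ![infGen E G ξ x, v] = (mfderiv 𝓘(ℝ, E) 𝓘(ℝ, ℝ) (fun y => J y ξ) x : E →L[ℝ] ℝ) v
  equivariant : ∀ (g : G) (x : M), J (g • x) = Coad g (J x)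

/-- `μ` is a regular value of `J`: the differential of `J` is onto at each point of `J⁻¹(μ)`. -/
def IsRegularValue (J : M → F →L[ℝ] ℝ) (μ : F →L[ℝ] ℝ) : Prop :=
  ∀ x ∈ J ⁻¹' {μ}, Function.Surjective (mfderiv 𝓘(ℝ, E) 𝓘(ℝ, F →L[ℝ] ℝ) J x)

/-- The equivalence relation on `J⁻¹(μ)` of lying in one orbit of `G_μ`. -/
def levelSetoid (G : Type*) [TopologicalSpace G] [ChartedSpace F G] [Group G]
    [LieGroup 𝓘(ℝ, F) ∞ G] {M : Type*} [MulAction G M]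
    (J : M → F →L[ℝ] ℝ) (μ : F →L[ℝ] ℝ) : Setoid (J ⁻¹' {μ}) :=
  (MulAction.orbitRel (isotropy G μ) M).comap Subtype.val

/-- The reduced space `M_μ = J⁻¹(μ) / G_μ`, with the quotient topology. -/
abbrev ReducedSpace (G : Type*) [TopologicalSpace G] [ChartedSpace F G] [Group G]
    [LieGroup 𝓘(ℝ, F) ∞ G] {M : Type*} [MulAction G M]
    (J : M → F →L[ℝ] ℝ) (μ : F →L[ℝ] ℝ) :=
  Quotient (levelSetoid G J μ)

/-- The projection `π_μ : J⁻¹(μ) → M_μ`. -/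
def reducedProj (G : Type*) [TopologicalSpace G] [ChartedSpace F G] [Group G]
    [LieGroup 𝓘(ℝ, F) ∞ G] {M : Type*} [MulAction G M]
    (J : M → F →L[ℝ] ℝ) (μ : F →L[ℝ] ℝ) : J ⁻¹' {μ} → ReducedSpace G J μ :=
  Quotient.mk (levelSetoid G J μ)

end Action

end CosymplecticReduction

end

noncomputable section

namespace CosymplecticReduction

/-! ### The chain rule between model spaces -/

section Flat

variable {E₁ E₂ E₃ H₁ H₂ H₃ : Type*} [NormedAddCommGroup E₁] [NormedSpace ℝ E₁]
  [NormedAddCommGroup E₂] [NormedSpace ℝ E₂] [NormedAddCommGroup E₃] [NormedSpace ℝ E₃]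
  [TopologicalSpace H₁] [TopologicalSpace H₂] [TopologicalSpace H₃]
  {I₁ : ModelWithCorners ℝ E₁ H₁} {I₂ : ModelWithCorners ℝ E₂ H₂} {I₃ : ModelWithCorners ℝ E₃ H₃}
  {X Y Z : Type*} [TopologicalSpace X] [TopologicalSpace Y] [TopologicalSpace Z]
  [ChartedSpace H₁ X] [ChartedSpace H₂ Y] [ChartedSpace H₃ Z]

/-! Regularity of `μ` and the moment identity make the infinitesimal action injective along
`J⁻¹(μ)`, since a generator that vanishes pairs to zero with the image of `dJ`, which is all of
`𝔤^*` (`IsMomentumMap.injective_orbit`). By equivariance, two points of `J⁻¹(μ)` in one `G`-orbit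
already lie in one `G_μ`-orbit (`reducedProj_eq_iff`). So `M_μ` is studied through the `G`-orbits
alone, and no smooth structure on `G_μ` is used.

The geometric core is `exists_adaptedChart`. Freeness and properness give a local submersion `p`
whose fibres are the orbits (`exists_slice`). The orbits meet `J⁻¹(μ)` in directions of constant
dimension `k`: differentiating the equivariance shows that this is the dimension of the kernel of
the derivative at `1` of `g ↦ Coad g μ`. Constant rank then yields charts of `M` of the form `(J -
μ, b, c)` in which `c` labels the orbits inside `J⁻¹(μ)`. Setting the first component to `0` gives
charts `(b, c)` of the level set, and `c` alone gives charts of `M_μ`. In these the inclusion is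
`(b, c) ↦ (0, b, c)` and the projection is `(b, c) ↦ c`.

A form on `M` descends once it is invariant and its restriction kills the orbit directions
(`exists_pullback_reducedProj_eq`). For `ω` the first is assumed, and the second holds because
`ω(ξ_M, w) = ⟨dJ(w), ξ⟩` vanishes for `w` tangent to the level set. For `η` the second is assumed,
and the first follows from closedness and connectedness of `G` (`closed_one_form_invariant`). Local
sections of the projection exhibit the reduced forms in charts as pullbacks from `M`, hence smooth
and closed (`isSmooth_isClosed_of_pullback_eq`). Uniqueness holds because the projection is a
surjective submersion.

Nondegeneracy is linear algebra (`cosymplectic_reduction_pointwise`): a vector spanning `ker ω` is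
tangent to the level set, and its image spans the kernel of the reduced 2-form because the
`ω`-orthogonal of the level set consists of the orbit directions plus `ker ω`. -/

/-- The chain rule, with the tangent spaces replaced by the model spaces. -/
theorem mfderiv_comp_model {f : X → Y} {g : Y → Z} {x : X} {y : Y} (hy : f x = y)
    (hg : MDifferentiableAt I₂ I₃ g y) (hf : MDifferentiableAt I₁ I₂ f x) :
    (mfderiv I₁ I₃ (fun z => g (f z)) x : E₁ →L[ℝ] E₃) =
      (mfderiv I₂ I₃ g y : E₂ →L[ℝ] E₃).comp (mfderiv I₁ I₂ f x : E₁ →L[ℝ] E₂) := by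
  subst hy
  exact mfderiv_comp x hg hf

end Flat

/-! ### The inverse function theorem -/

section InverseFunction

/-- The inverse function theorem for smooth maps on open sets of Banach spaces. -/
theorem exists_openPartialHomeomorph_of_fderiv_bijective
    {E V : Type*} [NormedAddCommGroup E] [NormedSpace ℝ E] [CompleteSpace E]
    [NormedAddCommGroup V] [NormedSpace ℝ V] [CompleteSpace V]
    {f : E → V} {s : Set E} {x : E} (hs : IsOpen s) (hx : x ∈ s) (hf : ContDiffOn ℝ ∞ f s)
    (hb : Function.Bijective (fderiv ℝ f x)) :
    ∃ Φ : OpenPartialHomeomorph E V, x ∈ Φ.source ∧ Φ.source ⊆ s ∧ (∀ y, Φ y = f y) ∧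
      ContDiffOn ℝ ∞ Φ.symm Φ.target := by
  have hfx : ContDiffAt ℝ ∞ f x := hf.contDiffAt (hs.mem_nhds hx)
  set f' : E ≃L[ℝ] V := ContinuousLinearEquiv.ofBijective (fderiv ℝ f x)
    (LinearMap.ker_eq_bot.2 hb.1) (LinearMap.range_eq_top.2 hb.2) with hf'
  have hfd : HasFDerivAt f (f' : E →L[ℝ] V) x := by
    rw [hf', ContinuousLinearEquiv.coe_ofBijective]
    exact (hfx.differentiableAt (by simp)).hasFDerivAt
  set Ψ := hfx.toOpenPartialHomeomorph f hfd (by simp)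
  -- Restricting to the open set of points with invertible derivative makes the inverse smooth on
  -- the whole target, not only at the image of `x`.
  set t : Set E := s ∩ (fderiv ℝ f) ⁻¹' (Set.range ((↑) : (E ≃L[ℝ] V) → E →L[ℝ] V))
  have ht : IsOpen t := (hf.continuousOn_fderiv_of_isOpen hs (by simp)).isOpen_inter_preimage hs
    ContinuousLinearEquiv.isOpen
  have hxt : x ∈ t := ⟨hx, f', by rw [hfd.fderiv]⟩
  refine ⟨Ψ.restrOpen t ht, ⟨hfx.mem_toOpenPartialHomeomorph_source hfd (by simp), hxt⟩,
    fun y hy => hy.2.1, fun y => rfl, fun y hy => ?_⟩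
  refine ContDiffAt.contDiffWithinAt ?_
  have hy' := (Ψ.restrOpen t ht).map_target hy
  obtain ⟨e, he⟩ := hy'.2.2
  have hfy : ContDiffAt ℝ ∞ f ((Ψ.restrOpen t ht).symm y) :=
    hf.contDiffAt (hs.mem_nhds hy'.2.1)
  refine (Ψ.restrOpen t ht).contDiffAt_symm (f₀' := e) hy ?_ hfy
  rw [he]
  exact (hfy.differentiableAt (by simp)).hasFDerivAt

/-- The inverse function theorem for smooth maps from a manifold without boundary to a Banach
space. -/
theorem exists_openPartialHomeomorph_of_mfderiv_bijective
    {E V : Type*} [NormedAddCommGroup E] [NormedSpace ℝ E] [CompleteSpace E]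
    [NormedAddCommGroup V] [NormedSpace ℝ V] [CompleteSpace V]
    {H : Type*} [TopologicalSpace H] {I : ModelWithCorners ℝ E H} [I.Boundaryless]
    {X : Type*} [TopologicalSpace X] [ChartedSpace H X] [IsManifold I ∞ X]
    {f : X → V} {s : Set X} {x : X} (hs : IsOpen s) (hx : x ∈ s)
    (hf : ContMDiffOn I 𝓘(ℝ, V) ∞ f s)
    (hb : Function.Bijective (mfderiv I 𝓘(ℝ, V) f x)) :
    ∃ Φ : OpenPartialHomeomorph X V, x ∈ Φ.source ∧ Φ.source ⊆ s ∧ (∀ y ∈ Φ.source, Φ y = f y) ∧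
      (∃ ε > 0, Φ.target = Metric.ball (f x) ε) ∧
      ContMDiffOn I 𝓘(ℝ, V) ∞ Φ Φ.source ∧ ContMDiffOn 𝓘(ℝ, V) I ∞ Φ.symm Φ.target := by
  set χ := extChartAt I x with hχ
  have hxχ : x ∈ χ.source := mem_extChartAt_source x
  have hTo : IsOpen χ.target := isOpen_extChartAt_target x
  have hsym : ContMDiffOn 𝓘(ℝ, E) I ∞ χ.symm χ.target := contMDiffOn_extChartAt_symm x
  set t : Set E := χ.target ∩ χ.symm ⁻¹' s with ht
  have hto : IsOpen t := hsym.continuousOn.isOpen_inter_preimage hTo hs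
  have hxt : χ x ∈ t := ⟨mem_extChartAt_target x, by simpa [ht, hχ] using hx⟩
  have hg : ContDiffOn ℝ ∞ (f ∘ χ.symm) t := by
    rw [← contMDiffOn_iff_contDiffOn]
    exact hf.comp (hsym.mono Set.inter_subset_left) fun y hy => hy.2
  have hfx : MDifferentiableAt I 𝓘(ℝ, V) f x :=
    (hf.contMDiffAt (hs.mem_nhds hx)).mdifferentiableAt (by simp)
  have hbf : Function.Bijective (fderiv ℝ (f ∘ χ.symm) (χ x)) := by
    have e : mfderiv I 𝓘(ℝ, V) f x = fderiv ℝ (f ∘ χ.symm) (χ x) := by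
      rw [hfx.mfderiv, writtenInExtChartAt, I.range_eq_univ, fderivWithin_univ]
      rfl
    rw [← e]; exact hb
  obtain ⟨Ψ, hΨx, hΨs, hΨf, hΨsm⟩ :=
    exists_openPartialHomeomorph_of_fderiv_bijective hto hxt hg hbf
  set K : OpenPartialHomeomorph X E :=
    (chartAt H x).trans I.toHomeomorph.toOpenPartialHomeomorph with hK
  have hKs : K.source = χ.source := by simp [hK, hχ]
  have hKc : ∀ y, K y = χ y := fun y => rfl
  have hKsy : ∀ y, K.symm y = χ.symm y := fun y => rfl
  set Φ := K.trans Ψ with hΦ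
  have hΦsrc : ∀ y, y ∈ Φ.source ↔ y ∈ χ.source ∧ χ y ∈ Ψ.source := by
    intro y; rw [hΦ, OpenPartialHomeomorph.trans_source, hKs]; rfl
  have hΦf : ∀ y ∈ Φ.source, Φ y = f y := by
    intro y hy
    rw [hΦsrc] at hy
    rw [hΦ, OpenPartialHomeomorph.trans_apply, hKc, hΨf, Function.comp_apply,
      χ.left_inv hy.1]
  have hΦx : x ∈ Φ.source := (hΦsrc x).2 ⟨hxχ, hΨx⟩
  have hΦs : Φ.source ⊆ s := by
    intro y hy
    rw [hΦsrc] at hy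
    have := (hΨs hy.2).2
    rwa [Set.mem_preimage, χ.left_inv hy.1] at this
  have hsymΦ : ContMDiffOn 𝓘(ℝ, V) I ∞ Φ.symm Φ.target := by
    have h1 : ContMDiffOn 𝓘(ℝ, V) 𝓘(ℝ, E) ∞ Ψ.symm Ψ.target := hΨsm.contMDiffOn
    refine (hsym.comp (h1.mono (fun y hy => ?_)) (t := χ.target) (s := Φ.target) ?_)
    · exact hy.1
    · intro y hy
      exact (hΨs (Ψ.map_target hy.1)).1
  -- The target is cut down to a ball because adapted charts need convex slices.
  obtain ⟨ε, hε, hball⟩ := Metric.isOpen_iff.1 Φ.open_target (f x)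
    (by rw [← hΦf x hΦx]; exact Φ.map_source hΦx)
  clear_value Φ
  have hsub : ∀ y ∈ ((Φ.symm.restrOpen (Metric.ball (f x) ε) Metric.isOpen_ball).symm).source,
      y ∈ Φ.source := fun y hy => by simpa using hy.1
  refine ⟨(Φ.symm.restrOpen (Metric.ball (f x) ε) Metric.isOpen_ball).symm, ?_, ?_, ?_,
    ⟨ε, hε, ?_⟩, ?_, ?_⟩
  · have := Φ.map_source hΦx
    simp [hΦf x hΦx, hε, hΦx]
  · exact fun y hy => hΦs (hsub y hy)
  · exact fun y hy => hΦf y (hsub y hy)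
  · change Φ.target ∩ Metric.ball (f x) ε = _
    exact Set.inter_eq_right.2 hball
  · exact (hf.mono fun y hy => hΦs (hsub y hy)).congr fun y hy => hΦf y (hsub y hy)
  · exact hsymΦ.mono fun y hy => hy.1

end InverseFunction

/-! ### Slices for free proper actions -/

section Slice

/-- For a free proper action, an element moving a point near `x₀` to a point near `x₀` is close
to the identity. -/
theorem exists_nhds_forall_smul_mem_imp_mem {G M : Type*} [TopologicalSpace G] [Group G]
    [TopologicalSpace M] [MulAction G M] (hfree : ∀ (g : G) (x : M), g • x = x → g = 1)
    [ProperSMul G M] (x₀ : M) {W : Set G} (hW : W ∈ 𝓝 (1 : G)) [T2Space M] :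
    ∃ U : Set M, IsOpen U ∧ x₀ ∈ U ∧ ∀ y ∈ U, ∀ g : G, g • y ∈ U → g ∈ W := by
  -- A proper map is closed, so the pairs `(g • y, y)` with `g` outside the interior of `W` form a
  -- closed set. By freeness it misses `(x₀, x₀)`, hence a product neighbourhood of that point.
  have hcl : IsClosed ((fun p : G × M => (p.1 • p.2, p.2)) '' ((interior W)ᶜ ×ˢ Set.univ)) :=
    ProperSMul.isProperMap_smul_pair.isClosedMap _ (isOpen_interior.isClosed_compl.prod isClosed_univ)
  have hx : (x₀, x₀) ∈ ((fun p : G × M => (p.1 • p.2, p.2)) '' ((interior W)ᶜ ×ˢ Set.univ))ᶜ := by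
    rintro ⟨⟨g, y⟩, ⟨hg, -⟩, he⟩
    simp only [Prod.mk.injEq] at he
    obtain ⟨h1, rfl⟩ := he
    rw [hfree g y h1] at hg
    exact hg (mem_interior_iff_mem_nhds.2 hW)
  obtain ⟨U, V, hU, hV, hxU, hxV, hUV⟩ := isOpen_prod_iff.1 hcl.isOpen_compl x₀ x₀ hx
  refine ⟨U ∩ V, hU.inter hV, ⟨hxU, hxV⟩, fun y hy g hgy => ?_⟩
  by_contra hg
  exact hUV (Set.mk_mem_prod hgy.1 hy.2) ⟨(g, y), ⟨fun h => hg (interior_subset h), trivial⟩, rfl⟩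

variable {E : Type*} [NormedAddCommGroup E] [NormedSpace ℝ E] [FiniteDimensional ℝ E]
  {M : Type*} [TopologicalSpace M] [T2Space M] [ChartedSpace E M] [IsManifold 𝓘(ℝ, E) ∞ M]
  {F : Type*} [NormedAddCommGroup F] [NormedSpace ℝ F] [FiniteDimensional ℝ F]
  {G : Type*} [TopologicalSpace G] [ChartedSpace F G] [Group G] [LieGroup 𝓘(ℝ, F) ∞ G]
  [MulAction G M] [ContMDiffSMul 𝓘(ℝ, F) 𝓘(ℝ, E) ∞ G M]

omit [FiniteDimensional ℝ E] [T2Space M] [IsManifold 𝓘(ℝ, E) ∞ M] [FiniteDimensional ℝ F]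
  [LieGroup 𝓘(ℝ, F) ∞ G] in
variable (E F) in
theorem contMDiff_smul_const (x : M) :
    ContMDiff 𝓘(ℝ, F) 𝓘(ℝ, E) ∞ (fun g : G => g • x) :=
  (contMDiff_smul (I := 𝓘(ℝ, F)) (I' := 𝓘(ℝ, E)) (G := G) (M := M)).comp
    (contMDiff_id.prodMk contMDiff_const)

/-- Near a point where the infinitesimal action is injective, the orbits of a free proper action
are the level sets of a submersion onto a vector space. -/
theorem exists_slice (hfree : ∀ (g : G) (x : M), g • x = x → g = 1) [ProperSMul G M] (x₀ : M)
    (hinj : Function.Injective fun ξ : F => infGen E G ξ x₀) :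
    ∃ (N : Submodule ℝ E) (U : Set M) (p : M → N), IsOpen U ∧ x₀ ∈ U ∧
      ContMDiffOn 𝓘(ℝ, E) 𝓘(ℝ, N) ∞ p U ∧
      (∀ y ∈ U, ∀ y' ∈ U, p y = p y' ↔ ∃ g : G, g • y = y') ∧
      (∀ y ∈ U, Function.Surjective (mfderiv 𝓘(ℝ, E) 𝓘(ℝ, N) p y)) ∧
      Module.finrank ℝ F + Module.finrank ℝ N = Module.finrank ℝ E := by
  have : CompleteSpace E := FiniteDimensional.complete ℝ E
  have : CompleteSpace F := FiniteDimensional.complete ℝ F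
  have : IsTopologicalGroup G := topologicalGroup_of_lieGroup 𝓘(ℝ, F) ∞
  set χ := extChartAt 𝓘(ℝ, E) x₀ with hχ
  have hx₀ : x₀ ∈ χ.source := mem_extChartAt_source x₀
  have hTo : IsOpen χ.target := isOpen_extChartAt_target x₀
  have hSo : IsOpen χ.source := isOpen_extChartAt_source x₀
  have hχs : ContMDiffOn 𝓘(ℝ, E) 𝓘(ℝ, E) ∞ χ χ.source := by
    simpa [hχ] using contMDiffOn_extChartAt (I := 𝓘(ℝ, E)) (x := x₀) (n := ∞)
  have hχd : MDifferentiableAt 𝓘(ℝ, E) 𝓘(ℝ, E) χ x₀ :=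
    (hχs.contMDiffAt (hSo.mem_nhds hx₀)).mdifferentiableAt (by simp)
  have hsym : ContMDiffOn 𝓘(ℝ, E) 𝓘(ℝ, E) ∞ χ.symm χ.target := contMDiffOn_extChartAt_symm x₀
  have horb := contMDiff_smul_const E F (G := G) (M := M)
  -- the orbit directions in the chart
  set a : F →L[ℝ] E := (mfderiv 𝓘(ℝ, E) 𝓘(ℝ, E) χ x₀ : E →L[ℝ] E).comp
    (mfderiv 𝓘(ℝ, F) 𝓘(ℝ, E) (fun g : G => g • x₀) 1 : F →L[ℝ] E) with ha
  have ha_inj : Function.Injective a := by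
    have h1 := (isInvertible_mfderiv_extChartAt (I := 𝓘(ℝ, E)) hx₀).injective
    exact h1.comp hinj
  have hmf : mfderiv 𝓘(ℝ, F) 𝓘(ℝ, E) (fun g : G => χ (g • x₀)) 1 = a := by
    exact mfderiv_comp_model (one_smul G x₀) hχd ((horb x₀).mdifferentiableAt (by simp))
  obtain ⟨N, hN⟩ := Submodule.exists_isCompl a.range
  have : CompleteSpace N := FiniteDimensional.complete ℝ N
  -- The group moves a transversal to the orbit. At `(1, 0)` the derivative of `χ ∘ Θ` is `(ξ, n) ↦
  -- a ξ + n`, bijective because `N` is a complement of the range of `a`. The submersion `p` will be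
  -- the `N`-component of the local inverse.
  let Θ : G × N → M := fun q => q.1 • χ.symm (χ x₀ + q.2)
  set O₁ : Set (G × N) := {q | χ x₀ + (q.2 : E) ∈ χ.target} with hO₁
  have hO₁o : IsOpen O₁ := hTo.preimage (by fun_prop)
  have hΘ : ContMDiffOn (𝓘(ℝ, F).prod 𝓘(ℝ, N)) 𝓘(ℝ, E) ∞ Θ O₁ := by
    have h1 : ContMDiff (𝓘(ℝ, F).prod 𝓘(ℝ, N)) 𝓘(ℝ, E) ∞
        (fun q : G × N => χ x₀ + (q.2 : E)) := by
      have : ContMDiff 𝓘(ℝ, N) 𝓘(ℝ, E) ∞ (fun n : N => χ x₀ + (n : E)) :=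
        (contDiff_const.add N.subtypeL.contDiff).contMDiff
      exact this.comp contMDiff_snd
    have h2 := hsym.comp h1.contMDiffOn (s := O₁) (fun q hq => hq)
    exact (contMDiffOn_fst.smul h2 : _)
  set O : Set (G × N) := O₁ ∩ Θ ⁻¹' χ.source with hO
  have hOo : IsOpen O := hΘ.continuousOn.isOpen_inter_preimage hO₁o hSo
  have hΘ1 : Θ (1, 0) = x₀ := by simp [Θ, hχ]
  have h1O : ((1 : G), (0 : N)) ∈ O := by
    refine ⟨?_, ?_⟩
    · simp [hO₁, hχ]
    · rw [Set.mem_preimage, hΘ1]; exact hx₀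
  have hf : ContMDiffOn (𝓘(ℝ, F).prod 𝓘(ℝ, N)) 𝓘(ℝ, E) ∞ (χ ∘ Θ) O :=
    hχs.comp (hΘ.mono Set.inter_subset_left) fun q hq => hq.2
  have hder : ∀ v : F × N, mfderiv (𝓘(ℝ, F).prod 𝓘(ℝ, N)) 𝓘(ℝ, E) (χ ∘ Θ) ((1 : G), (0 : N)) v
      = a v.1 + (v.2 : E) := by
    intro v
    have hd : MDifferentiableAt (𝓘(ℝ, F).prod 𝓘(ℝ, N)) 𝓘(ℝ, E) (χ ∘ Θ) ((1 : G), (0 : N)) :=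
      (hf.contMDiffAt (hOo.mem_nhds h1O)).mdifferentiableAt (by simp)
    have e1 : (fun g : G => (χ ∘ Θ) (g, (0 : N))) = fun g : G => χ (g • x₀) := by
      ext g; simp [Θ, hχ]
    have e2 : (fun n : N => (χ ∘ Θ) ((1 : G), n)) =ᶠ[𝓝 0] fun n : N => χ x₀ + (n : E) := by
      have : ∀ᶠ n : N in 𝓝 0, χ x₀ + (n : E) ∈ χ.target := by
        have hc : ContinuousAt (fun n : N => χ x₀ + (n : E)) 0 := by fun_prop
        exact hc (hTo.mem_nhds (by simp [hχ]))
      filter_upwards [this] with n hn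
      simp only [Function.comp_apply, Θ, one_smul]
      exact χ.right_inv hn
    have e3 : mfderiv 𝓘(ℝ, N) 𝓘(ℝ, E) (fun n : N => (χ ∘ Θ) ((1 : G), n)) 0 = N.subtypeL := by
      rw [e2.mfderiv_eq, mfderiv_eq_fderiv]
      exact (N.subtypeL.hasFDerivAt.const_add _).fderiv
    refine (mfderiv_prod_eq_add_apply (v := v) hd).trans ?_
    have e4 : (mfderiv 𝓘(ℝ, F) 𝓘(ℝ, E) (fun g : G => (χ ∘ Θ) (g, (0 : N))) 1 : F →L[ℝ] E) = a := by
      rw [e1, hmf]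
    exact congrArg₂ (· + ·) (congrArg (fun l : F →L[ℝ] E => l v.1) e4)
      (congrArg (fun l : N →L[ℝ] E => l v.2) e3)
  have hbij : Function.Bijective
      (mfderiv (𝓘(ℝ, F).prod 𝓘(ℝ, N)) 𝓘(ℝ, E) (χ ∘ Θ) ((1 : G), (0 : N))) := by
    have h : Function.Bijective (a.coprod N.subtypeL) := by
      constructor
      · refine (injective_iff_map_eq_zero _).2 fun v hv => ?_
        have hv : a v.1 + (v.2 : E) = 0 := hv
        have h2 : (v.2 : E) ∈ a.range := by
          rw [eq_neg_of_add_eq_zero_right hv]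
          exact a.range.neg_mem ⟨v.1, rfl⟩
        have h3 : (v.2 : E) = 0 := (Submodule.disjoint_def.1 hN.disjoint) _ h2 v.2.2
        rw [h3, add_zero] at hv
        exact Prod.ext (ha_inj (hv.trans a.map_zero.symm)) (Subtype.ext h3)
      · intro w
        obtain ⟨_, ⟨ξ, rfl⟩, n, hn, h⟩ := Submodule.mem_sup.1
          ((hN.sup_eq_top ▸ Submodule.mem_top : (w : E) ∈ a.range ⊔ N))
        exact ⟨(ξ, ⟨n, hn⟩), h⟩
    have e : (⇑(a.coprod N.subtypeL) : F × N → E) = fun v =>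
      mfderiv (𝓘(ℝ, F).prod 𝓘(ℝ, N)) 𝓘(ℝ, E) (χ ∘ Θ) ((1 : G), (0 : N)) v :=
      funext fun v => (hder v).symm
    rw [e] at h
    exact h
  obtain ⟨Φ, h1Φ, hΦO, hΦf, -, hΦs, hΦsym⟩ :=
    exists_openPartialHomeomorph_of_mfderiv_bijective hOo h1O hf hbij
  have hdim : Module.finrank ℝ F + Module.finrank ℝ N = Module.finrank ℝ E := by
    rw [← Submodule.finrank_add_eq_of_isCompl hN]
    congr 1
    exact (LinearMap.finrank_range_of_inj (f := (a : F →ₗ[ℝ] E)) ha_inj).symm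
  set p : M → N := fun y => (Φ.symm (χ y)).2 with hp
  set U₀ : Set M := χ.source ∩ χ ⁻¹' Φ.target with hU₀
  have hU₀o : IsOpen U₀ := hχs.continuousOn.isOpen_inter_preimage hSo Φ.open_target
  have hχ1 : χ x₀ = Φ (1, 0) := by rw [hΦf _ h1Φ, Function.comp_apply, hΘ1]
  have hx₀U₀ : x₀ ∈ U₀ := ⟨hx₀, by rw [Set.mem_preimage, hχ1]; exact Φ.map_source h1Φ⟩
  have hΦχ : Φ.symm (χ x₀) = (1, 0) := by rw [hχ1, Φ.left_inv h1Φ]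
  have hrep : ∀ y ∈ U₀, Θ (Φ.symm (χ y)) = y := by
    intro y hy
    have h1 := Φ.map_target hy.2
    have h2 := Φ.right_inv hy.2
    rw [hΦf _ h1] at h2
    exact χ.injOn (hΦO h1).2 hy.1 h2
  -- If `y` has coordinates `(h, n)`, then `g • y` should have coordinates `(g * h, n)`. This is
  -- justified only while that pair stays in the domain where `Φ` is injective, that is for `g` in
  -- some `W` and `y` in some `V`. Properness then forces `g ∈ W` when `y` and `g • y` are both near
  -- `x₀`.
  have hcont : ContinuousAt (fun q : G × M =>
      ((q.1 * (Φ.symm (χ q.2)).1, (Φ.symm (χ q.2)).2) : G × N)) (1, x₀) := by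
    have h1 : ContinuousAt (fun y : M => Φ.symm (χ y)) x₀ := by
      refine ContinuousAt.comp (g := Φ.symm) (f := χ) ?_ hχd.continuousAt
      exact Φ.symm.continuousAt hx₀U₀.2
    have h2 : ContinuousAt (fun q : G × M => Φ.symm (χ q.2)) (1, x₀) :=
      ContinuousAt.comp (g := fun y : M => Φ.symm (χ y)) (f := Prod.snd) h1 continuousAt_snd
    exact (continuousAt_fst.mul h2.fst).prodMk h2.snd
  have hev : ∀ᶠ q : G × M in 𝓝 (1, x₀),
      ((q.1 * (Φ.symm (χ q.2)).1, (Φ.symm (χ q.2)).2) : G × N) ∈ Φ.source := by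
    refine hcont.eventually (Φ.open_source.mem_nhds ?_)
    simpa [hΦχ] using h1Φ
  rw [nhds_prod_eq] at hev
  obtain ⟨W, hW, V, hV, hWV⟩ := Filter.mem_prod_iff.1 hev
  obtain ⟨U₁, hU₁o, hx₀U₁, hU₁⟩ := exists_nhds_forall_smul_mem_imp_mem hfree x₀ hW
  have hpU : ContMDiffOn 𝓘(ℝ, E) 𝓘(ℝ, N) ∞ p U₀ := by
    have h1 := hΦsym.comp (hχs.mono (Set.inter_subset_left : U₀ ⊆ _)) (fun y hy => hy.2)
    exact contMDiff_snd.comp_contMDiffOn h1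
  refine ⟨N, U₀ ∩ (U₁ ∩ interior V), p, hU₀o.inter (hU₁o.inter isOpen_interior),
    ⟨hx₀U₀, hx₀U₁, mem_interior_iff_mem_nhds.2 hV⟩, hpU.mono Set.inter_subset_left, ?_, ?_, hdim⟩
  · rintro y ⟨hy₀, hy₁, hy₂⟩ y' ⟨hy'₀, hy'₁, hy'₂⟩
    constructor
    · intro he
      refine ⟨(Φ.symm (χ y')).1 * (Φ.symm (χ y)).1⁻¹, ?_⟩
      have e1 := hrep y hy₀
      have e2 := hrep y' hy'₀
      simp only [Θ] at e1 e2
      have he' : (Φ.symm (χ y)).2 = (Φ.symm (χ y')).2 := he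
      calc _ = ((Φ.symm (χ y')).1 * (Φ.symm (χ y)).1⁻¹) • (Φ.symm (χ y)).1 •
            χ.symm (χ x₀ + ↑(Φ.symm (χ y)).2) := by rw [e1]
        _ = y' := by rw [smul_smul, inv_mul_cancel_right, he', e2]
    · rintro ⟨g, rfl⟩
      have hgW := hU₁ y hy₁ g hy'₁
      have hmem : ((g * (Φ.symm (χ y)).1, (Φ.symm (χ y)).2) : G × N) ∈ Φ.source :=
        hWV (Set.mk_mem_prod hgW (interior_subset hy₂))
      have e : Φ (g * (Φ.symm (χ y)).1, (Φ.symm (χ y)).2) = χ (g • y) := by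
        rw [hΦf _ hmem]
        conv_rhs => rw [← hrep y hy₀]
        simp only [Function.comp_apply, Θ, mul_smul]
      have := congrArg Prod.snd (congrArg Φ.symm e)
      rw [Φ.left_inv hmem] at this
      exact this
  · rintro y ⟨hy₀, -⟩
    have d1 : MDifferentiableAt 𝓘(ℝ, E) 𝓘(ℝ, E) χ y :=
      (hχs.contMDiffAt (hSo.mem_nhds hy₀.1)).mdifferentiableAt (by simp)
    have d2 : MDifferentiableAt 𝓘(ℝ, E) (𝓘(ℝ, F).prod 𝓘(ℝ, N)) Φ.symm (χ y) :=
      (hΦsym.contMDiffAt (Φ.open_target.mem_nhds hy₀.2)).mdifferentiableAt (by simp)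
    have hΦM : Φ.MDifferentiable (𝓘(ℝ, F).prod 𝓘(ℝ, N)) 𝓘(ℝ, E) :=
      ⟨hΦs.mdifferentiableOn (by simp), hΦsym.mdifferentiableOn (by simp)⟩
    have s1 := (isInvertible_mfderiv_extChartAt (I := 𝓘(ℝ, E)) hy₀.1).surjective
    have s2 := hΦM.symm.mfderiv_surjective hy₀.2
    have e := mfderiv_comp y (mdifferentiableAt_snd (x := Φ.symm (χ y))) (d2.comp y d1)
    rw [mfderiv_comp y d2 d1, mfderiv_snd] at e
    intro w
    obtain ⟨u, hu⟩ := s2 ((0, w) : F × N)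
    obtain ⟨v, hv⟩ := s1 u
    refine ⟨v, ?_⟩
    have e' : mfderiv 𝓘(ℝ, E) 𝓘(ℝ, N) p y = _ := e
    rw [e']
    change (mfderiv 𝓘(ℝ, E) (𝓘(ℝ, F).prod 𝓘(ℝ, N)) Φ.symm (χ y)
      (mfderiv 𝓘(ℝ, E) 𝓘(ℝ, E) χ y v) : F × N).2 = w
    rw [hv, hu]

end Slice

/-! ### Derivatives as maps of model spaces -/

section Tmap

variable {E₁ E₂ E₃ : Type*} [NormedAddCommGroup E₁] [NormedSpace ℝ E₁]
  [NormedAddCommGroup E₂] [NormedSpace ℝ E₂] [NormedAddCommGroup E₃] [NormedSpace ℝ E₃]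
  {X Y Z : Type*} [TopologicalSpace X] [TopologicalSpace Y] [TopologicalSpace Z]
  [ChartedSpace E₁ X] [ChartedSpace E₂ Y] [ChartedSpace E₃ Z]

variable (E₁ E₂) in
/-- The manifold derivative as a map between the model spaces. -/
def tmap (f : X → Y) (x : X) : E₁ →L[ℝ] E₂ := mfderiv 𝓘(ℝ, E₁) 𝓘(ℝ, E₂) f x

theorem tmap_comp {f : X → Y} {g : Y → Z} {x : X} {y : Y} (hy : f x = y)
    (hg : MDifferentiableAt 𝓘(ℝ, E₂) 𝓘(ℝ, E₃) g y) (hf : MDifferentiableAt 𝓘(ℝ, E₁) 𝓘(ℝ, E₂) f x) :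
    tmap E₁ E₃ (fun z => g (f z)) x = (tmap E₂ E₃ g y).comp (tmap E₁ E₂ f x) :=
  mfderiv_comp_model hy hg hf

theorem tmap_congr {f g : X → Y} {x : X} (h : f =ᶠ[𝓝 x] g) : tmap E₁ E₂ f x = tmap E₁ E₂ g x :=
  h.mfderiv_eq

theorem tmap_const (x : X) (y : Y) : tmap E₁ E₂ (fun _ : X => y) x = 0 :=
  mfderiv_const

theorem tmap_id (x : X) : tmap E₁ E₁ (fun y : X => y) x = ContinuousLinearMap.id ℝ E₁ :=
  mfderiv_id

theorem tmap_eq_of_hasFDerivAt {f : E₁ → E₂} {f' : E₁ →L[ℝ] E₂} {x : E₁} (h : HasFDerivAt f f' x) :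
    tmap E₁ E₂ f x = f' :=
  mfderiv_eq_fderiv.trans h.fderiv

theorem tmap_hasFDerivAt_comp {f : X → E₂} {g : E₂ → E₃} {g' : E₂ →L[ℝ] E₃} {x : X}
    (hg : HasFDerivAt g g' (f x)) (hf : MDifferentiableAt 𝓘(ℝ, E₁) 𝓘(ℝ, E₂) f x) :
    tmap E₁ E₃ (fun z => g (f z)) x = g'.comp (tmap E₁ E₂ f x) := by
  rw [tmap_comp rfl hg.differentiableAt.mdifferentiableAt hf, tmap_eq_of_hasFDerivAt hg]

end Tmap

/-! ### Linear model of the adapted coordinates -/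

section LinearAlgebra

/-- Given a surjection `a` and a map `b` on a finite-dimensional space, `a` and a linear function
of `b` are two components of a coordinate system. -/
theorem exists_bijective_prod {V A N : Type*} [NormedAddCommGroup V] [NormedSpace ℝ V]
    [FiniteDimensional ℝ V] [NormedAddCommGroup A] [NormedSpace ℝ A] [FiniteDimensional ℝ A]
    [NormedAddCommGroup N] [NormedSpace ℝ N] [FiniteDimensional ℝ N] {k d : ℕ}
    (a : V →L[ℝ] A) (b : V →L[ℝ] N) (ha : Function.Surjective a)
    (hk : Module.finrank ℝ (a.ker ⊓ b.ker : Submodule ℝ V) = k)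
    (hd : Module.finrank ℝ V = Module.finrank ℝ A + k + d) :
    ∃ (L : N →L[ℝ] EuclideanSpace ℝ (Fin d)) (r : V →L[ℝ] EuclideanSpace ℝ (Fin k)),
      Function.Bijective (a.prod (r.prod (L.comp b))) := by
  set b' : a.ker →ₗ[ℝ] N := (b : V →ₗ[ℝ] N).domRestrict a.ker with hb'
  have h1 : Module.finrank ℝ a.ker = k + d := by
    have h := LinearMap.finrank_range_add_finrank_ker (a : V →ₗ[ℝ] A)
    rw [LinearMap.range_eq_top.2 ha, finrank_top] at h
    change _ + Module.finrank ℝ a.ker = _ at h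
    omega
  have h2 : Module.finrank ℝ b'.ker = k := by
    rw [← hk]
    have e : b'.ker.map a.ker.subtype = (a.ker ⊓ b.ker : Submodule ℝ V) := by
      rw [hb', LinearMap.ker_domRestrict, Submodule.map_comap_subtype]
    rw [← e]
    exact (Submodule.finrank_map_subtype_eq _ _).symm
  have h3 : Module.finrank ℝ b'.range = d := by
    have h := LinearMap.finrank_range_add_finrank_ker b'
    omega
  have eL : b'.range ≃ₗ[ℝ] EuclideanSpace ℝ (Fin d) :=
    LinearEquiv.ofFinrankEq _ _ (by rw [h3, finrank_euclideanSpace_fin])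
  have er : (a.ker ⊓ b.ker : Submodule ℝ V) ≃ₗ[ℝ] EuclideanSpace ℝ (Fin k) :=
    LinearEquiv.ofFinrankEq _ _ (by rw [hk, finrank_euclideanSpace_fin])
  -- `L` is an isomorphism on the image of `ker a` under `b`, and `r` is one on `ker a ⊓ ker b`. A
  -- vector killed by all three components thus lies in `ker a`, then in `ker b`, then is zero;
  -- surjectivity follows by dimension.
  obtain ⟨L, hL⟩ := LinearMap.exists_extend (eL : b'.range →ₗ[ℝ] EuclideanSpace ℝ (Fin d))
  obtain ⟨r, hr⟩ := LinearMap.exists_extend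
    (er : (a.ker ⊓ b.ker : Submodule ℝ V) →ₗ[ℝ] EuclideanSpace ℝ (Fin k))
  refine ⟨LinearMap.toContinuousLinearMap L, LinearMap.toContinuousLinearMap r, ?_⟩
  set T := a.prod ((LinearMap.toContinuousLinearMap r).prod
    ((LinearMap.toContinuousLinearMap L).comp b))
  have hinj : Function.Injective T := by
    refine (injective_iff_map_eq_zero T).2 fun v hv => ?_
    obtain ⟨hv1, hv2⟩ := Prod.mk.inj hv
    obtain ⟨hv2, hv3⟩ := Prod.mk.inj hv2
    change r v = 0 at hv2
    change L (b v) = 0 at hv3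
    have hbr : b v ∈ b'.range := ⟨⟨v, hv1⟩, rfl⟩
    have e1 : eL ⟨b v, hbr⟩ = 0 := by
      have := LinearMap.congr_fun hL ⟨b v, hbr⟩
      exact this.symm.trans hv3
    have hbv : b v = 0 := congrArg Subtype.val (eL.map_eq_zero_iff.1 e1)
    have e2 : er ⟨v, hv1, hbv⟩ = 0 := by
      have := LinearMap.congr_fun hr ⟨v, hv1, hbv⟩
      exact this.symm.trans hv2
    exact congrArg Subtype.val (er.map_eq_zero_iff.1 e2)
  refine ⟨hinj, ?_⟩
  refine (LinearMap.injective_iff_surjective_of_finrank_eq_finrank (f := T.toLinearMap) ?_).1 hinj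
  simp only [Module.finrank_prod, finrank_euclideanSpace_fin]
  omega

end LinearAlgebra

/-! ### Adapted charts near the level set -/

section Adapted

variable {E : Type*} [NormedAddCommGroup E] [NormedSpace ℝ E]
  {M : Type*} [TopologicalSpace M] [ChartedSpace E M]
  {F : Type*} [NormedAddCommGroup F] [NormedSpace ℝ F]
  {G : Type*} [TopologicalSpace G] [ChartedSpace F G] [Group G]
  [MulAction G M]

/-- The product of vector spaces in which adapted charts take their values. -/
abbrev Coords (F : Type*) [NormedAddCommGroup F] [NormedSpace ℝ F] (k d : ℕ) :=
  (F →L[ℝ] ℝ) × EuclideanSpace ℝ (Fin k) × EuclideanSpace ℝ (Fin d)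

variable (E) in
/-- A chart of `M` around a point of `J⁻¹(μ)` whose first component is `J - μ` and whose last
component has the intersections of the `G`-orbits with `J⁻¹(μ)` as level sets in `J⁻¹(μ)`. -/
structure AdaptedChart (G : Type*) [TopologicalSpace G] [ChartedSpace F G] [Group G]
    [MulAction G M] (J : M → F →L[ℝ] ℝ) (μ : F →L[ℝ] ℝ) (k d : ℕ) (x₀ : M) where
  /-- The underlying partial homeomorphism. -/
  Φ : OpenPartialHomeomorph M (Coords F k d)
  /-- The radius of the target. -/
  ε : ℝ
  ε_pos : 0 < ε
  mem_source : x₀ ∈ Φ.source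
  -- The norm of `Coords` is a maximum, so this ball is a product of balls: components may be set to
  -- `0`, and slices with one free component are convex.
  target_eq : Φ.target = Metric.ball 0 ε
  smooth : ContMDiffOn 𝓘(ℝ, E) 𝓘(ℝ, Coords F k d) ∞ Φ Φ.source
  smooth_symm : ContMDiffOn 𝓘(ℝ, Coords F k d) 𝓘(ℝ, E) ∞ Φ.symm Φ.target
  fst_eq : ∀ y ∈ Φ.source, (Φ y).1 = J y - μ
  rel : ∀ y ∈ Φ.source, ∀ y' ∈ Φ.source, J y = μ → J y' = μ →
    ((Φ y).2.2 = (Φ y').2.2 ↔ ∃ g : G, g • y = y')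
  -- The infinitesimal form of `rel`; it will identify the kernel of the differential of the
  -- projection to `M_μ`.
  ker : ∀ y ∈ Φ.source, J y = μ → ∀ v : E, tmap E (F →L[ℝ] ℝ) J y v = 0 →
    ((tmap E (Coords F k d) Φ y v).2.2 = 0 ↔ ∃ ξ : F, tmap F E (fun g : G => g • y) 1 ξ = v)

end Adapted

section Existence

variable {E : Type*} [NormedAddCommGroup E] [NormedSpace ℝ E] [FiniteDimensional ℝ E]
  {M : Type*} [TopologicalSpace M] [T2Space M] [ChartedSpace E M] [IsManifold 𝓘(ℝ, E) ∞ M]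
  {F : Type*} [NormedAddCommGroup F] [NormedSpace ℝ F] [FiniteDimensional ℝ F]
  {G : Type*} [TopologicalSpace G] [ChartedSpace F G] [Group G] [LieGroup 𝓘(ℝ, F) ∞ G]
  [MulAction G M] [ContMDiffSMul 𝓘(ℝ, F) 𝓘(ℝ, E) ∞ G M]

theorem exists_adaptedChart (hfree : ∀ (g : G) (x : M), g • x = x → g = 1) [ProperSMul G M]
    {J : M → F →L[ℝ] ℝ} (hJ : ContMDiff 𝓘(ℝ, E) 𝓘(ℝ, F →L[ℝ] ℝ) ∞ J) {μ : F →L[ℝ] ℝ} {k d : ℕ}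
    (hsurj : ∀ y : M, J y = μ → Function.Surjective (tmap E (F →L[ℝ] ℝ) J y))
    (hinj : ∀ y : M, J y = μ → Function.Injective (tmap F E (fun g : G => g • y) 1))
    (hk : ∀ y : M, J y = μ → Module.finrank ℝ ((tmap E (F →L[ℝ] ℝ) J y).ker ⊓
      (tmap F E (fun g : G => g • y) 1).range : Submodule ℝ E) = k)
    (hd : Module.finrank ℝ E = Module.finrank ℝ F + k + d) {x₀ : M} (hx₀ : J x₀ = μ) :
    Nonempty (AdaptedChart E G J μ k d x₀) := by
  have : CompleteSpace E := FiniteDimensional.complete ℝ E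
  obtain ⟨N, U, p, hUo, hxU, hp, hrel, hps, hN⟩ := exists_slice (F := F) hfree x₀ (hinj x₀ hx₀)
  change ∀ y ∈ U, Function.Surjective (tmap E N p y) at hps
  have hpd : ∀ y ∈ U, MDifferentiableAt 𝓘(ℝ, E) 𝓘(ℝ, N) p y := fun y hy =>
    (hp.contMDiffAt (hUo.mem_nhds hy)).mdifferentiableAt (by simp)
  have hJd : ∀ y, MDifferentiableAt 𝓘(ℝ, E) 𝓘(ℝ, F →L[ℝ] ℝ) J y := fun y =>
    (hJ y).mdifferentiableAt (by simp)
  have hod : ∀ y : M, MDifferentiableAt 𝓘(ℝ, F) 𝓘(ℝ, E) (fun g : G => g • y) 1 := fun y =>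
    (contMDiff_smul_const E F y 1).mdifferentiableAt (by simp)
  have hkerp : ∀ y ∈ U, J y = μ →
      (tmap E N p y).ker = (tmap F E (fun g : G => g • y) 1).range := by
    intro y hy hyμ
    -- Near `y` the map `p` is constant along the orbit, which gives one inclusion; the dimensions
    -- agree because the infinitesimal action is injective and `p` is a submersion.
    refine (Submodule.eq_of_le_of_finrank_eq ?_ ?_).symm
    · rintro _ ⟨ξ, rfl⟩
      have h1 : (fun g : G => p (g • y)) =ᶠ[𝓝 1] fun _ => p y := by
        have hc : ContinuousAt (fun g : G => g • y) 1 := (hod y).continuousAt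
        filter_upwards [hc (hUo.mem_nhds (by simpa using hy))] with g hg
        exact ((hrel y hy _ hg).2 ⟨g, rfl⟩).symm
      have h2 := tmap_comp (f := fun g : G => g • y) (one_smul G y) (hpd y hy) (hod y)
      rw [tmap_congr h1, tmap_const] at h2
      exact (congrArg (fun l : F →L[ℝ] N => l ξ) h2).symm
    · have h1 := LinearMap.finrank_range_add_finrank_ker (tmap E N p y : E →ₗ[ℝ] N)
      rw [LinearMap.range_eq_top.2 (hps y hy), finrank_top] at h1
      have h2 := LinearMap.finrank_range_of_inj (f := (tmap F E (fun g : G => g • y) 1 : F →ₗ[ℝ] E))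
        (hinj y hyμ)
      change Module.finrank ℝ (tmap F E (fun g : G => g • y) 1).range = _ at h2
      change _ + Module.finrank ℝ (tmap E N p y).ker = _ at h1
      omega
  have hdual : Module.finrank ℝ (F →L[ℝ] ℝ) = Module.finrank ℝ F := by
    rw [← (LinearMap.toContinuousLinearMap (𝕜 := ℝ) (E := F) (F' := ℝ)).finrank_eq]
    exact Subspace.dual_finrank_eq
  obtain ⟨L, r, hbij⟩ := exists_bijective_prod (k := k) (d := d) (tmap E (F →L[ℝ] ℝ) J x₀) (tmap E N p x₀)
    (hsurj x₀ hx₀) (by rw [hkerp x₀ hxU hx₀]; exact hk x₀ hx₀) (by rw [hdual, hd])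
  set χ := extChartAt 𝓘(ℝ, E) x₀ with hχ
  have hxχ : x₀ ∈ χ.source := mem_extChartAt_source x₀
  have hχs : ContMDiffOn 𝓘(ℝ, E) 𝓘(ℝ, E) ∞ χ χ.source := by
    simpa [hχ] using contMDiffOn_extChartAt (I := 𝓘(ℝ, E)) (x := x₀) (n := ∞)
  have hSo : IsOpen χ.source := isOpen_extChartAt_source x₀
  obtain ⟨D, hD⟩ : (tmap E E χ x₀).IsInvertible :=
    isInvertible_mfderiv_extChartAt (I := 𝓘(ℝ, E)) hxχ
  -- Undoing the derivative `D` of the chart makes `r` the derivative of `r' ∘ χ` at `x₀`.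
  set r' : E →L[ℝ] EuclideanSpace ℝ (Fin k) := r.comp (D.symm : E →L[ℝ] E) with hr'
  set s : Set M := U ∩ χ.source with hs
  let f : M → Coords F k d := fun y => (J y - μ, r' (χ y) - r' (χ x₀), L (p y) - L (p x₀))
  have hf : ContMDiffOn 𝓘(ℝ, E) 𝓘(ℝ, Coords F k d) ∞ f s := by
    refine ContMDiffOn.prodMk_space ?_ (ContMDiffOn.prodMk_space ?_ ?_)
    · exact (hJ.sub contMDiff_const).contMDiffOn
    · have h1 : ContMDiff 𝓘(ℝ, E) 𝓘(ℝ, EuclideanSpace ℝ (Fin k)) ∞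
          (fun z : E => r' z - r' (χ x₀)) := (r'.contDiff.sub contDiff_const).contMDiff
      exact h1.comp_contMDiffOn (hχs.mono Set.inter_subset_right)
    · have h1 : ContMDiff 𝓘(ℝ, N) 𝓘(ℝ, EuclideanSpace ℝ (Fin d)) ∞
          (fun z : N => L z - L (p x₀)) := (L.contDiff.sub contDiff_const).contMDiff
      exact h1.comp_contMDiffOn (hp.mono Set.inter_subset_left)
  have hso : IsOpen s := hUo.inter hSo
  have hxs : x₀ ∈ s := ⟨hxU, hxχ⟩
  have hfd : ∀ y ∈ s, MDifferentiableAt 𝓘(ℝ, E) 𝓘(ℝ, Coords F k d) f y := fun y hy =>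
    (hf.contMDiffAt (hso.mem_nhds hy)).mdifferentiableAt (by simp)
  have hf1 : ∀ y ∈ s, ∀ v, (tmap E (Coords F k d) f y v).1 = tmap E (F →L[ℝ] ℝ) J y v := by
    intro y hy v
    have h1 := tmap_hasFDerivAt_comp (g := Prod.fst) hasFDerivAt_fst (hfd y hy)
    have h2 := tmap_hasFDerivAt_comp (g := fun z => z - μ) ((hasFDerivAt_id (J y)).sub_const μ)
      (hJd y)
    exact congrArg (fun l : E →L[ℝ] (F →L[ℝ] ℝ) => l v) (h1.symm.trans h2)
  have hs1 : ∀ z : Coords F k d, HasFDerivAt (fun z : Coords F k d => z.2.1)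
      ((ContinuousLinearMap.fst ℝ (EuclideanSpace ℝ (Fin k)) (EuclideanSpace ℝ (Fin d))).comp
        (ContinuousLinearMap.snd ℝ (F →L[ℝ] ℝ) _)) z :=
    fun z => hasFDerivAt_fst.comp z hasFDerivAt_snd
  have hs2 : ∀ z : Coords F k d, HasFDerivAt (fun z : Coords F k d => z.2.2)
      ((ContinuousLinearMap.snd ℝ (EuclideanSpace ℝ (Fin k)) (EuclideanSpace ℝ (Fin d))).comp
        (ContinuousLinearMap.snd ℝ (F →L[ℝ] ℝ) _)) z :=
    fun z => hasFDerivAt_snd.comp z hasFDerivAt_snd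
  have hf3 : ∀ y ∈ s, ∀ v, (tmap E (Coords F k d) f y v).2.2 = L (tmap E N p y v) := by
    intro y hy v
    have h1 := tmap_hasFDerivAt_comp (g := fun z : Coords F k d => z.2.2) (hs2 _)
      (hfd y hy)
    have h2 := tmap_hasFDerivAt_comp (g := fun z => L z - L (p x₀))
      (L.hasFDerivAt.sub_const (L (p x₀))) (hpd y hy.1)
    exact congrArg (fun l : E →L[ℝ] EuclideanSpace ℝ (Fin d) => l v) (h1.symm.trans h2)
  have hf2 : ∀ v, (tmap E (Coords F k d) f x₀ v).2.1 = r v := by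
    intro v
    have h1 := tmap_hasFDerivAt_comp (g := fun z : Coords F k d => z.2.1) (hs1 _)
      (hfd x₀ hxs)
    have h2 := tmap_hasFDerivAt_comp (g := fun z => r' z - r' (χ x₀))
      (r'.hasFDerivAt.sub_const (r' (χ x₀)))
      ((hχs.contMDiffAt (hSo.mem_nhds hxχ)).mdifferentiableAt (by simp))
    have h3 := congrArg (fun l : E →L[ℝ] EuclideanSpace ℝ (Fin k) => l v) (h1.symm.trans h2)
    refine h3.trans ?_
    change r (D.symm (tmap E E χ x₀ v)) = r v
    rw [← hD]
    simp
  have hbf : Function.Bijective (mfderiv 𝓘(ℝ, E) 𝓘(ℝ, Coords F k d) f x₀) := by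
    have e : (⇑((tmap E (F →L[ℝ] ℝ) J x₀).prod (r.prod (L.comp (tmap E N p x₀)))) :
        E → Coords F k d) = fun v => mfderiv 𝓘(ℝ, E) 𝓘(ℝ, Coords F k d) f x₀ v :=
      funext fun v => Prod.ext (hf1 x₀ hxs v).symm (Prod.ext (hf2 v).symm (hf3 x₀ hxs v).symm)
    rw [e] at hbij
    exact hbij
  obtain ⟨Φ, hxΦ, hΦs, hΦf, ⟨ε, hε, htar⟩, hΦsm, hΦsy⟩ :=
    exists_openPartialHomeomorph_of_mfderiv_bijective hso hxs hf hbf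
  have hfx : f x₀ = 0 := by simp [f, hx₀]
  rw [hfx] at htar
  have hΦM : Φ.MDifferentiable 𝓘(ℝ, E) 𝓘(ℝ, Coords F k d) :=
    ⟨hΦsm.mdifferentiableOn (by simp), hΦsy.mdifferentiableOn (by simp)⟩
  have hΦt : ∀ y ∈ Φ.source, tmap E (Coords F k d) Φ y = tmap E (Coords F k d) f y := by
    intro y hy
    refine tmap_congr ?_
    filter_upwards [Φ.open_source.mem_nhds hy] with z hz using hΦf z hz
  have hΦinj : ∀ y ∈ Φ.source, Function.Injective (tmap E (Coords F k d) Φ y) :=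
    fun y hy => hΦM.mfderiv_injective hy
  -- on the level set, the kernel of the last component is tangent to the orbits
  have hker : ∀ y ∈ Φ.source, J y = μ → ∀ v, tmap E (F →L[ℝ] ℝ) J y v = 0 →
      L (tmap E N p y v) = 0 → tmap E N p y v = 0 := by
    intro y hy hyμ v hv1 hv2
    -- Here `K₁ ≤ K₂`. The dimension of `K₁` is `k` by the constant-rank hypothesis, while that of
    -- `K₂` is at most `k` since the middle component of the injective derivative of `Φ` is
    -- injective on it. Hence the two are equal.
    set K₁ : Submodule ℝ E := (tmap E (F →L[ℝ] ℝ) J y).ker ⊓ (tmap E N p y).ker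
    set K₂ : Submodule ℝ E := (tmap E (F →L[ℝ] ℝ) J y).ker ⊓ (L.comp (tmap E N p y)).ker
    have h12 : K₁ ≤ K₂ := fun w hw => ⟨hw.1, by
      have : tmap E N p y w = 0 := hw.2
      change L (tmap E N p y w) = 0
      rw [this, map_zero]⟩
    have hK₁ : Module.finrank ℝ K₁ = k := by
      have := hk y hyμ
      rwa [← hkerp y (hΦs hy).1 hyμ] at this
    have hK₂ : Module.finrank ℝ K₂ ≤ k := by
      let l : K₂ →ₗ[ℝ] EuclideanSpace ℝ (Fin k) :=
        (((ContinuousLinearMap.fst ℝ _ _).comp (ContinuousLinearMap.snd ℝ _ _)).comp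
          (tmap E (Coords F k d) Φ y) : E →ₗ[ℝ] EuclideanSpace ℝ (Fin k)).domRestrict K₂
      have hl : Function.Injective l := by
        refine (injective_iff_map_eq_zero l).2 fun w hw => ?_
        have h1 : tmap E (Coords F k d) Φ y w = 0 := by
          refine Prod.ext ?_ (Prod.ext hw ?_)
          · rw [hΦt y hy, hf1 y (hΦs hy)]; exact w.2.1
          · rw [hΦt y hy, hf3 y (hΦs hy)]; exact w.2.2
        exact Subtype.ext (hΦinj y hy (h1.trans (map_zero _).symm))
      simpa using LinearMap.finrank_le_finrank_of_injective hl
    have hKK : K₁ = K₂ := Submodule.eq_of_le_of_finrank_le h12 (by omega)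
    have hvK : v ∈ K₂ := ⟨hv1, hv2⟩
    rw [← hKK] at hvK
    exact hvK.2
  -- The last component is only `L ∘ p` up to a constant, and `L` may lose information. Yet on a
  -- slice `J = μ`, `L ∘ p` constant, the derivative of `p` itself vanishes by `hker`; the slice is
  -- a ball in the middle coordinate, so `p` is constant there.
  have hpq : ∀ y ∈ Φ.source, ∀ y' ∈ Φ.source, J y = μ → J y' = μ →
      (Φ y).2.2 = (Φ y').2.2 → p y = p y' := by
    intro y hy y' hy' hyμ hy'μ he
    set c := (Φ y).2.2 with hc
    have e1 : Φ y = (0, (Φ y).2.1, c) := by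
      refine Prod.ext ?_ (Prod.ext rfl rfl)
      rw [hΦf y hy]; simp [f, hyμ]
    have e2 : Φ y' = (0, (Φ y').2.1, c) := by
      refine Prod.ext ?_ (Prod.ext rfl he.symm)
      rw [hΦf y' hy']; simp [f, hy'μ]
    have m1 : (Φ y) ∈ Metric.ball (0 : Coords F k d) ε := htar ▸ Φ.map_source hy
    have m2 : (Φ y') ∈ Metric.ball (0 : Coords F k d) ε := htar ▸ Φ.map_source hy'
    rw [e1] at m1
    rw [e2] at m2
    simp only [Metric.mem_ball, dist_zero_right, Prod.norm_mk, max_lt_iff] at m1 m2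
    let ι : EuclideanSpace ℝ (Fin k) → Coords F k d := fun b => (0, b, c)
    have hι : ∀ b, HasFDerivAt ι ((ContinuousLinearMap.inr ℝ (F →L[ℝ] ℝ) _).comp
        (ContinuousLinearMap.inl ℝ (EuclideanSpace ℝ (Fin k)) (EuclideanSpace ℝ (Fin d)))) b := by
      intro b
      have e : ι = fun b => ((ContinuousLinearMap.inr ℝ (F →L[ℝ] ℝ) _).comp (ContinuousLinearMap.inl
          ℝ (EuclideanSpace ℝ (Fin k)) (EuclideanSpace ℝ (Fin d)))) b + (0, 0, c) := by
        funext b; simp [ι]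
      rw [e]
      exact (ContinuousLinearMap.hasFDerivAt _).add_const _
    have hιm : ∀ b ∈ Metric.ball (0 : EuclideanSpace ℝ (Fin k)) ε, ι b ∈ Φ.target := by
      intro b hb
      rw [htar]
      simp only [ι, Metric.mem_ball, dist_zero_right, Prod.norm_mk, max_lt_iff, norm_zero] at hb ⊢
      exact ⟨hε, hb, m1.2.2⟩
    have hu : ∀ b ∈ Metric.ball (0 : EuclideanSpace ℝ (Fin k)) ε,
        HasFDerivAt (fun b => p (Φ.symm (ι b))) (0 : EuclideanSpace ℝ (Fin k) →L[ℝ] N) b := by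
      intro b hb
      have hz := hιm b hb
      have hzs := Φ.map_target hz
      have d1 : MDifferentiableAt 𝓘(ℝ, Coords F k d) 𝓘(ℝ, E) Φ.symm (ι b) :=
        hΦM.mdifferentiableAt_symm hz
      have d2 : MDifferentiableAt 𝓘(ℝ, EuclideanSpace ℝ (Fin k)) 𝓘(ℝ, Coords F k d) ι b :=
        (hι b).differentiableAt.mdifferentiableAt
      have d3 := hpd _ (hΦs hzs).1
      have t1 := tmap_comp rfl d1 d2
      have t2 := tmap_comp (f := fun b => Φ.symm (ι b)) rfl d3 (d1.comp b d2)
      have t0 : tmap (EuclideanSpace ℝ (Fin k)) N (fun b => p (Φ.symm (ι b))) b = 0 := by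
        rw [t2, t1]
        ext1 β
        set v : E := tmap (Coords F k d) E Φ.symm (ι b) (0, β, 0) with hv
        have hTv : tmap E (Coords F k d) Φ (Φ.symm (ι b)) v = (0, β, 0) := by
          have := hΦM.comp_symm_deriv hz
          exact congrArg (fun l : Coords F k d →L[ℝ] Coords F k d => l (0, β, 0)) this
        rw [hΦt _ hzs] at hTv
        have hJz : J (Φ.symm (ι b)) = μ := by
          have h1 := congrArg Prod.fst (Φ.right_inv hz)
          rw [hΦf _ hzs] at h1
          exact sub_eq_zero.1 h1
        have := hker _ hzs hJz v (by rw [← hf1 _ (hΦs hzs), hTv])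
          (by rw [← hf3 _ (hΦs hzs), hTv])
        rw [tmap_eq_of_hasFDerivAt (hι b)]
        exact this
      have hdiff : DifferentiableAt ℝ (fun b => p (Φ.symm (ι b))) b :=
        (d3.comp b (d1.comp b d2)).differentiableAt
      have := hdiff.hasFDerivAt
      rwa [← mfderiv_eq_fderiv, show mfderiv 𝓘(ℝ, EuclideanSpace ℝ (Fin k)) 𝓘(ℝ, N)
        (fun b => p (Φ.symm (ι b))) b = 0 from t0] at this
    have hconst := (convex_ball (0 : EuclideanSpace ℝ (Fin k)) ε).is_const_of_fderivWithin_eq_zero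
      (𝕜 := ℝ) (f := fun b => p (Φ.symm (ι b)))
      (fun b hb => (hu b hb).differentiableAt.differentiableWithinAt)
      (fun b hb => by
        rw [fderivWithin_of_isOpen Metric.isOpen_ball hb, (hu b hb).fderiv])
      (x := (Φ y).2.1) (y := (Φ y').2.1) (by simpa using m1.2.1) (by simpa using m2.2.1)
    have e1' : Φ.symm (ι (Φ y).2.1) = y := by
      change Φ.symm (0, (Φ y).2.1, c) = y
      rw [← e1, Φ.left_inv hy]
    have e2' : Φ.symm (ι (Φ y').2.1) = y' := by
      change Φ.symm (0, (Φ y').2.1, c) = y'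
      rw [← e2, Φ.left_inv hy']
    simpa only [e1', e2'] using hconst
  refine ⟨⟨Φ, ε, hε, hxΦ, htar, hΦsm, hΦsy, fun y hy => by rw [hΦf y hy], ?_, ?_⟩⟩
  · intro y hy y' hy' hyμ hy'μ
    rw [← hrel y (hΦs hy).1 y' (hΦs hy').1]
    refine ⟨hpq y hy y' hy' hyμ hy'μ, fun h => ?_⟩
    rw [hΦf y hy, hΦf y' hy']
    simp [f, h]
  · intro y hy hyμ v hv
    rw [hΦt y hy, hf3 y (hΦs hy)]
    have h1 : (∃ ξ : F, tmap F E (fun g : G => g • y) 1 ξ = v) ↔ tmap E N p y v = 0 := by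
      change v ∈ (tmap F E (fun g : G => g • y) 1).range ↔ v ∈ (tmap E N p y).ker
      rw [hkerp y (hΦs hy).1 hyμ]
    rw [h1]
    exact ⟨hker y hy hyμ v hv, fun h => by rw [h, map_zero]⟩

end Existence

/-! ### Smoothness and closedness of pulled back forms -/

section PullbackAlternating

variable {V W : Type*} [NormedAddCommGroup V] [NormedSpace ℝ V]
  [NormedAddCommGroup W] [NormedSpace ℝ W] {k : ℕ}

/-- A linear retraction onto alternating maps transfers smoothness of composition from multilinear
maps, where composition is itself multilinear in the linear maps. -/
theorem exists_leftInverse_toContinuousMultilinearMap [FiniteDimensional ℝ V] :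
    ∃ S : ContinuousMultilinearMap ℝ (fun _ : Fin k => V) ℝ →L[ℝ] (V [⋀^Fin k]→L[ℝ] ℝ),
      ∀ f, S (ContinuousAlternatingMap.toContinuousMultilinearMapCLM ℝ f) = f := by
  have h1 : FiniteDimensional ℝ (ContinuousMultilinearMap ℝ (fun _ : Fin k => V) ℝ) :=
    Module.Finite.of_injective
      (ContinuousMultilinearMap.toMultilinearMapLinear :
        ContinuousMultilinearMap ℝ (fun _ : Fin k => V) ℝ →ₗ[ℝ] _) ContinuousMultilinearMap.toMultilinearMap_injective
  obtain ⟨S, hS⟩ := LinearMap.exists_leftInverse_of_injective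
    (ContinuousAlternatingMap.toContinuousMultilinearMapCLM ℝ :
      (V [⋀^Fin k]→L[ℝ] ℝ) →L[ℝ] _).toLinearMap
    (LinearMap.ker_eq_bot.2 ContinuousAlternatingMap.toContinuousMultilinearMap_injective)
  exact ⟨LinearMap.toContinuousLinearMap S, fun f => LinearMap.congr_fun hS f⟩

theorem _root_.ContDiffAt.continuousAlternatingMap_compContinuousLinearMap
    [FiniteDimensional ℝ V] {X : Type*} [NormedAddCommGroup X] [NormedSpace ℝ X]
    {f : X → W [⋀^Fin k]→L[ℝ] ℝ} {g : X → V →L[ℝ] W} {x : X} {n : ℕ∞ω}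
    (hf : ContDiffAt ℝ n f x) (hg : ContDiffAt ℝ n g x) :
    ContDiffAt ℝ n (fun y => (f y).compContinuousLinearMap (g y)) x := by
  obtain ⟨S, hS⟩ := exists_leftInverse_toContinuousMultilinearMap (V := V) (k := k)
  have e : (fun y => (f y).compContinuousLinearMap (g y)) = fun y =>
      S ((ContinuousMultilinearMap.compContinuousLinearMapContinuousMultilinear ℝ
        (fun _ : Fin k => V) (fun _ : Fin k => W) ℝ (fun _ => g y))
        (ContinuousAlternatingMap.toContinuousMultilinearMapCLM ℝ (f y))) := by
    funext y
    exact (hS _).symm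
  rw [e]
  refine S.contDiff.contDiffAt.comp x (ContDiffAt.clm_apply ?_ ?_)
  · exact (ContinuousMultilinearMap.contDiff _).contDiffAt.comp x (contDiffAt_pi.2 fun _ => hg)
  · exact (ContinuousLinearMap.contDiff _).contDiffAt.comp x hf

end PullbackAlternating

section PullbackForm

variable {V : Type*} [NormedAddCommGroup V] [NormedSpace ℝ V]
  {E : Type*} [NormedAddCommGroup E] [NormedSpace ℝ E]
  {M : Type*} [TopologicalSpace M] [ChartedSpace E M] [IsManifold 𝓘(ℝ, E) ∞ M] {k : ℕ}

/-- The pullback of a form on `M` to a vector space, as a function into a fixed space. -/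
def modelPullback (τ : V → M) (α : DiffForm E M k) : V → V [⋀^Fin k]→L[ℝ] ℝ :=
  DiffForm.pullback (E := V) τ α

omit [IsManifold 𝓘(ℝ, E) ∞ M] in
theorem pullback_apply {X : Type*} [TopologicalSpace X] [ChartedSpace V X] (f : X → M)
    (α : DiffForm E M k) (x : X) (v : Fin k → V) :
    (DiffForm.pullback f α x : V [⋀^Fin k]→L[ℝ] ℝ) v =
      (α (f x) : E [⋀^Fin k]→L[ℝ] ℝ) (fun i => tmap V E f x (v i)) := rfl

/-- Locally, the pullback of a form on `M` to a vector space is the pullback of its coordinate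
expression. -/
theorem pullback_eq_pullback_inChart {τ : V → M} {T : Set V} (hT : IsOpen T)
    (hτ : ContMDiffOn 𝓘(ℝ, V) 𝓘(ℝ, E) ∞ τ T) (α : DiffForm E M k) {c₀ : V} (hc₀ : c₀ ∈ T) :
    ContDiffAt ℝ ∞ (fun c => extChartAt 𝓘(ℝ, E) (τ c₀) (τ c)) c₀ ∧
    (modelPullback τ α) =ᶠ[𝓝 c₀] fun c =>
      ((α.inChart (τ c₀) (extChartAt 𝓘(ℝ, E) (τ c₀) (τ c)) :
        E [⋀^Fin k]→L[ℝ] ℝ)).compContinuousLinearMap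
        (fderiv ℝ (fun c => extChartAt 𝓘(ℝ, E) (τ c₀) (τ c)) c) := by
  set χ := extChartAt 𝓘(ℝ, E) (τ c₀) with hχ
  have hSo : IsOpen χ.source := isOpen_extChartAt_source _
  have hTo : IsOpen χ.target := isOpen_extChartAt_target _
  have hχs : ContMDiffOn 𝓘(ℝ, E) 𝓘(ℝ, E) ∞ χ χ.source := by
    simpa [hχ] using contMDiffOn_extChartAt (I := 𝓘(ℝ, E)) (x := τ c₀) (n := ∞)
  have hsym : ContMDiffOn 𝓘(ℝ, E) 𝓘(ℝ, E) ∞ χ.symm χ.target := contMDiffOn_extChartAt_symm _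
  set T' := T ∩ τ ⁻¹' χ.source
  have hT'o : IsOpen T' := hτ.continuousOn.isOpen_inter_preimage hT hSo
  have hc₀' : c₀ ∈ T' := ⟨hc₀, mem_extChartAt_source _⟩
  have hcomp : ContMDiffOn 𝓘(ℝ, V) 𝓘(ℝ, E) ∞ (fun c => χ (τ c)) T' :=
    hχs.comp (hτ.mono Set.inter_subset_left) fun c hc => hc.2
  refine ⟨(hcomp.contMDiffAt (hT'o.mem_nhds hc₀')).contDiffAt, ?_⟩
  filter_upwards [hT'o.mem_nhds hc₀'] with c hc
  have d1 : MDifferentiableAt 𝓘(ℝ, V) 𝓘(ℝ, E) (fun c => χ (τ c)) c :=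
    (hcomp.contMDiffAt (hT'o.mem_nhds hc)).mdifferentiableAt (by simp)
  have d2 : MDifferentiableAt 𝓘(ℝ, E) 𝓘(ℝ, E) χ.symm (χ (τ c)) :=
    (hsym.contMDiffAt (hTo.mem_nhds (χ.map_source hc.2))).mdifferentiableAt (by simp)
  -- Inserting the chart and its inverse reduces the pullback to one along a map of vector spaces.
  have e1 : τ =ᶠ[𝓝 c] fun c => χ.symm (χ (τ c)) := by
    filter_upwards [hT'o.mem_nhds hc] with c' hc'
    exact (χ.left_inv hc'.2).symm
  have e2 : tmap V E τ c = (tmap E E χ.symm (χ (τ c))).comp (fderiv ℝ (fun c => χ (τ c)) c) := by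
    rw [tmap_congr e1, tmap_comp (f := fun c => χ (τ c)) rfl d2 d1]
    congr 1
    exact mfderiv_eq_fderiv
  ext v
  change (α (τ c) : E [⋀^Fin k]→L[ℝ] ℝ) (fun i => tmap V E τ c (v i)) = _
  rw [e2]
  change _ = (α (χ.symm (χ (τ c))) : E [⋀^Fin k]→L[ℝ] ℝ) _
  rw [χ.left_inv hc.2]
  rfl

/-- The pullback of a smooth form to an open subset of a vector space is smooth. -/
theorem contDiffOn_pullback [FiniteDimensional ℝ V] {τ : V → M} {T : Set V} (hT : IsOpen T)
    (hτ : ContMDiffOn 𝓘(ℝ, V) 𝓘(ℝ, E) ∞ τ T) {α : DiffForm E M k} (hα : α.IsSmooth) :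
    ContDiffOn ℝ ∞ (modelPullback τ α) T := by
  intro c₀ hc₀
  refine ContDiffAt.contDiffWithinAt ?_
  obtain ⟨h1, h2⟩ := pullback_eq_pullback_inChart hT hτ α hc₀
  refine ContDiffAt.congr_of_eventuallyEq ?_ h2
  refine ContDiffAt.continuousAlternatingMap_compContinuousLinearMap ?_ ?_
  · have h3 : ContDiffAt ℝ ∞ (α.inChart (τ c₀)) (extChartAt 𝓘(ℝ, E) (τ c₀) (τ c₀)) :=
      (hα (τ c₀)).contDiffAt ((isOpen_extChartAt_target _).mem_nhds (mem_extChartAt_target _))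
    exact h3.comp c₀ h1
  · exact h1.fderiv_right (by simp)

/-- The pullback of a smooth closed form to an open subset of a vector space is closed. -/
theorem extDeriv_pullback_eq_zero {τ : V → M} {T : Set V} (hT : IsOpen T)
    (hτ : ContMDiffOn 𝓘(ℝ, V) 𝓘(ℝ, E) ∞ τ T) {α : DiffForm E M k} (hα : α.IsSmooth)
    (hα' : α.IsClosed) {c₀ : V} (hc₀ : c₀ ∈ T) :
    extDeriv (modelPullback τ α) c₀ = 0 := by
  obtain ⟨h1, h2⟩ := pullback_eq_pullback_inChart hT hτ α hc₀
  have h3 : ContDiffAt ℝ ∞ (α.inChart (τ c₀)) (extChartAt 𝓘(ℝ, E) (τ c₀) (τ c₀)) :=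
    (hα (τ c₀)).contDiffAt ((isOpen_extChartAt_target _).mem_nhds (mem_extChartAt_target _))
  refine h2.extDeriv_eq.trans ?_
  -- The exterior derivative commutes with pullback between vector spaces.
  refine (extDeriv_pullback (f := fun c => extChartAt 𝓘(ℝ, E) (τ c₀) (τ c)) (h3.differentiableAt (by simp)) h1
    (by simp [minSmoothness_of_isRCLikeNormedField]; norm_cast)).trans ?_
  rw [hα' (τ c₀) _ (mem_extChartAt_target _)]
  rfl

end PullbackForm

/-! ### Invariance of a closed 1-form vanishing on orbits -/

section Invariance

variable {E : Type*} [NormedAddCommGroup E] [NormedSpace ℝ E]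
  {M : Type*} [TopologicalSpace M] [ChartedSpace E M] [IsManifold 𝓘(ℝ, E) ∞ M]

/-- A smooth closed `1`-form is locally exact. -/
theorem exists_local_primitive {η : DiffForm E M 1} (hs : η.IsSmooth) (hc : η.IsClosed) (y₀ : M) :
    ∃ (U : Set M) (f : M → ℝ), IsOpen U ∧ y₀ ∈ U ∧ ∀ y ∈ U,
      MDifferentiableAt 𝓘(ℝ, E) 𝓘(ℝ, ℝ) f y ∧
      ∀ v : E, tmap E ℝ f y v = (η y : E [⋀^Fin 1]→L[ℝ] ℝ) (fun _ => v) := by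
  set χ := extChartAt 𝓘(ℝ, E) y₀ with hχ
  have hSo : IsOpen χ.source := isOpen_extChartAt_source _
  have hTo : IsOpen χ.target := isOpen_extChartAt_target _
  have hχs : ContMDiffOn 𝓘(ℝ, E) 𝓘(ℝ, E) ∞ χ χ.source := by
    simpa [hχ] using contMDiffOn_extChartAt (I := 𝓘(ℝ, E)) (x := y₀) (n := ∞)
  have hsym : ContMDiffOn 𝓘(ℝ, E) 𝓘(ℝ, E) ∞ χ.symm χ.target := contMDiffOn_extChartAt_symm _
  obtain ⟨ε, hε, hball⟩ := Metric.isOpen_iff.1 hTo (χ y₀) (mem_extChartAt_target y₀)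
  set α : E → E [⋀^Fin 1]→L[ℝ] ℝ := η.inChart y₀ with hα
  have hαd : ∀ z ∈ χ.target, DifferentiableAt ℝ α z := fun z hz =>
    ((hs y₀).contDiffAt (hTo.mem_nhds hz)).differentiableAt (by simp)
  set w : E → E →L[ℝ] ℝ := fun z =>
    (ContinuousAlternatingMap.ofSubsingletonLIE (𝕜 := ℝ) (E := E) (F := ℝ) (0 : Fin 1)).symm (α z) with hw
  have hwa : ∀ z v, w z v = α z (fun _ => v) := fun z v => rfl
  have hwd : ∀ z ∈ χ.target, DifferentiableAt ℝ w z := fun z hz =>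
    (ContinuousAlternatingMap.ofSubsingletonLIE (𝕜 := ℝ) (E := E) (F := ℝ)
      (0 : Fin 1)).symm.toContinuousLinearEquiv.differentiableAt.comp z (hαd z hz)
  -- Closedness of a 1-form means that its derivative is symmetric; on a ball this produces a
  -- primitive.
  have hsymm : ∀ z ∈ χ.target, ∀ u v, fderiv ℝ w z u v = fderiv ℝ w z v u := by
    intro z hz u v
    have h1 := hc y₀ z hz
    have h2 := extDeriv_apply (hαd z hz) ![u, v]
    change extDeriv α z = 0 at h1
    rw [h1] at h2
    have h3 : ∀ a b : E, fderiv ℝ (fun z => α z (fun _ => a)) z b = fderiv ℝ w z b a := by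
      intro a b
      have : (fun z => α z (fun _ => a)) = fun z => w z a := by
        funext z; rw [hwa]
      rw [this, fderiv_clm_apply (hwd z hz) (differentiableAt_const a)]
      simp
    have e0 : (Fin.removeNth 0 ![u, v] : Fin 1 → E) = fun _ => v := by
      funext i; fin_cases i; rfl
    have e1 : (Fin.removeNth 1 ![u, v] : Fin 1 → E) = fun _ => u := by
      funext i; fin_cases i; rfl
    rw [Fin.sum_univ_two, e0, e1, h3, h3] at h2
    simp at h2
    linarith
  obtain ⟨f, hf⟩ := (convex_ball (χ y₀) ε).exists_forall_hasFDerivAt_of_fderiv_symmetric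
    Metric.isOpen_ball (fun z hz => (hwd z (hball hz)).differentiableWithinAt)
    (fun z hz => hsymm z (hball hz))
  refine ⟨χ.source ∩ χ ⁻¹' Metric.ball (χ y₀) ε, fun y => f (χ y),
    hχs.continuousOn.isOpen_inter_preimage hSo Metric.isOpen_ball,
    ⟨mem_extChartAt_source y₀, Metric.mem_ball_self hε⟩, fun y hy => ?_⟩
  have d1 : MDifferentiableAt 𝓘(ℝ, E) 𝓘(ℝ, E) χ y :=
    (hχs.contMDiffAt (hSo.mem_nhds hy.1)).mdifferentiableAt (by simp)
  have hd := hf _ hy.2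
  refine ⟨hd.differentiableAt.mdifferentiableAt.comp y d1, fun v => ?_⟩
  rw [tmap_hasFDerivAt_comp hd d1]
  have d2 : MDifferentiableAt 𝓘(ℝ, E) 𝓘(ℝ, E) χ.symm (χ y) :=
    (hsym.contMDiffAt (hTo.mem_nhds (χ.map_source hy.1))).mdifferentiableAt (by simp)
  have e1 : (fun z => χ.symm (χ z)) =ᶠ[𝓝 y] fun z => z := by
    filter_upwards [hSo.mem_nhds hy.1] with z hz using χ.left_inv hz
  have e2 := tmap_comp rfl d2 d1
  rw [tmap_congr e1, tmap_id] at e2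
  change (η (χ.symm (χ y)) : E [⋀^Fin 1]→L[ℝ] ℝ)
    (fun _ => tmap E E χ.symm (χ y) (tmap E E χ y v)) = _
  have e3 : tmap E E χ.symm (χ y) (tmap E E χ y v) = v :=
    (congrArg (fun l : E →L[ℝ] E => l v) e2).symm
  rw [e3, χ.left_inv hy.1]

variable {F : Type*} [NormedAddCommGroup F] [NormedSpace ℝ F]
  {G : Type*} [TopologicalSpace G] [ChartedSpace F G] [Group G] [LieGroup 𝓘(ℝ, F) ∞ G]
  [MulAction G M] [ContMDiffSMul 𝓘(ℝ, F) 𝓘(ℝ, E) ∞ G M]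

omit [IsManifold 𝓘(ℝ, E) ∞ M] in
/-- The velocity of an orbit at any group element is an infinitesimal generator. -/
theorem tmap_orbit_eq (g : G) (x : M) (ξ : F) :
    ∃ ξ' : F, tmap F E (fun h : G => h • x) g ξ = tmap F E (fun h : G => h • (g • x)) 1 ξ' := by
  have hd : MDifferentiableAt 𝓘(ℝ, F) 𝓘(ℝ, F) (fun h : G => h * g⁻¹) g :=
    (contMDiff_mul_right (I := 𝓘(ℝ, F)) (n := ∞) (a := g⁻¹)).mdifferentiableAt (by simp)
  have e : (fun h : G => h • x) = fun h : G => (h * g⁻¹) • (g • x) := by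
    funext h; rw [smul_smul, inv_mul_cancel_right]
  refine ⟨tmap F F (fun h : G => h * g⁻¹) g ξ, ?_⟩
  rw [e, tmap_comp (f := fun h : G => h * g⁻¹) (g := fun h : G => h • (g • x)) (mul_inv_cancel g)
    ((contMDiff_smul_const E F (g • x) 1).mdifferentiableAt (by simp)) hd]
  rfl

variable (F) in
/-- A closed `1`-form that vanishes on the orbits of a connected group is invariant. -/
theorem closed_one_form_invariant [ConnectedSpace G] {η : DiffForm E M 1}
    (hs : η.IsSmooth) (hc : η.IsClosed)
    (hη : ∀ (ξ : F) (x : M), (η x : E [⋀^Fin 1]→L[ℝ] ℝ)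
      (fun _ => tmap F E (fun g : G => g • x) 1 ξ) = 0) (g : G) (x : M) (v : E) :
    (η (g • x) : E [⋀^Fin 1]→L[ℝ] ℝ) (fun _ => tmap E E (fun y : M => g • y) x v) =
      (η x : E [⋀^Fin 1]→L[ℝ] ℝ) (fun _ => v) := by
  have hsm : ContMDiff (𝓘(ℝ, F).prod 𝓘(ℝ, E)) 𝓘(ℝ, E) ∞ (fun p : G × M => p.1 • p.2) :=
    contMDiff_smul
  have hac : Continuous (fun p : G × M => p.1 • p.2) := hsm.continuous
  have hgd : ∀ (g : G) (y : M), MDifferentiableAt 𝓘(ℝ, E) 𝓘(ℝ, E) (fun y : M => g • y) y :=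
    fun g y => (ContMDiffSMul.contMDiff_const_smul (I := 𝓘(ℝ, F)) (n := ∞) g).mdifferentiableAt
      (by simp)
  -- The value of `Φ_g^* η` at `x` on `v` is locally constant in `g`: near `g₀ • x` one has `η =
  -- df`, and `f (g • y)` does not depend on `g` near `g₀`, so neither does its derivative in `y`.
  -- Connectedness then compares `g` with `1`.
  have hloc : IsLocallyConstant fun g : G =>
      (η (g • x) : E [⋀^Fin 1]→L[ℝ] ℝ) (fun _ => tmap E E (fun y : M => g • y) x v) := by
    rw [IsLocallyConstant.iff_eventually_eq]
    intro g₀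
    obtain ⟨U, f, hU, hxU, hf⟩ := exists_local_primitive hs hc (g₀ • x)
    obtain ⟨W, V, hW, hV, hgW, hxV, hWV⟩ := isOpen_prod_iff.1 (hU.preimage hac) g₀ x hxU
    set ψ := extChartAt 𝓘(ℝ, F) g₀ with hψ
    have hψT : IsOpen ψ.target := isOpen_extChartAt_target _
    have hψs : ContMDiffOn 𝓘(ℝ, F) 𝓘(ℝ, F) ∞ ψ.symm ψ.target := contMDiffOn_extChartAt_symm _
    obtain ⟨ε, hε, hball⟩ := Metric.isOpen_iff.1
      (hψs.continuousOn.isOpen_inter_preimage hψT hW) (ψ g₀)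
      ⟨mem_extChartAt_target _, by simpa [hψ] using hgW⟩
    have hconst : ∀ y ∈ V, ∀ a ∈ Metric.ball (ψ g₀) ε, f (ψ.symm a • y) = f (g₀ • y) := by
      intro y hy a ha
      -- Velocities of an orbit are generators at the moved point by `tmap_orbit_eq`, and `df = η`
      -- vanishes on them.
      have hu : ∀ a ∈ Metric.ball (ψ g₀) ε,
          HasFDerivAt (fun a => f (ψ.symm a • y)) (0 : F →L[ℝ] ℝ) a := by
        intro a ha
        have ha' := hball ha
        have d1 : MDifferentiableAt 𝓘(ℝ, F) 𝓘(ℝ, F) ψ.symm a :=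
          (hψs.contMDiffAt (hψT.mem_nhds ha'.1)).mdifferentiableAt (by simp)
        have d2 : MDifferentiableAt 𝓘(ℝ, F) 𝓘(ℝ, E) (fun h : G => h • y) (ψ.symm a) :=
          (contMDiff_smul_const E F y _).mdifferentiableAt (by simp)
        have hUy := hf (ψ.symm a • y) (hWV (Set.mk_mem_prod ha'.2 hy))
        have d3 : MDifferentiableAt 𝓘(ℝ, F) 𝓘(ℝ, ℝ) (fun h : G => f (h • y)) (ψ.symm a) :=
          hUy.1.comp (I' := 𝓘(ℝ, E)) (ψ.symm a) d2
        have t1 := tmap_comp (f := fun h : G => h • y) rfl hUy.1 d2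
        have t2 := tmap_comp rfl d3 d1
        have t0 : tmap F ℝ (fun a => f (ψ.symm a • y)) a = 0 := by
          refine t2.trans ?_
          ext1 ξ
          have : tmap F ℝ (fun h : G => f (h • y)) (ψ.symm a) (tmap F F ψ.symm a ξ) = 0 := by
            obtain ⟨ξ', hξ'⟩ := tmap_orbit_eq (E := E) (ψ.symm a) y (tmap F F ψ.symm a ξ)
            have h4 := congrArg (fun l : F →L[ℝ] ℝ => l (tmap F F ψ.symm a ξ)) t1
            refine h4.trans ?_
            change tmap E ℝ f (ψ.symm a • y) (tmap F E (fun h : G => h • y) (ψ.symm a) _) = 0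
            rw [hξ', hUy.2, hη]
          exact this
        have hdiff : DifferentiableAt ℝ (fun a => f (ψ.symm a • y)) a :=
          (d3.comp a d1).differentiableAt
        have := hdiff.hasFDerivAt
        rwa [← mfderiv_eq_fderiv, show mfderiv 𝓘(ℝ, F) 𝓘(ℝ, ℝ) (fun a => f (ψ.symm a • y)) a = 0
          from t0] at this
      have h := (convex_ball (ψ g₀) ε).is_const_of_fderivWithin_eq_zero (𝕜 := ℝ)
        (fun b hb => (hu b hb).differentiableAt.differentiableWithinAt)
        (fun b hb => by rw [fderivWithin_of_isOpen Metric.isOpen_ball hb, (hu b hb).fderiv])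
        ha (Metric.mem_ball_self hε)
      rw [h]
      simp [hψ]
    have hder : ∀ g : G, g • x ∈ U → (η (g • x) : E [⋀^Fin 1]→L[ℝ] ℝ)
        (fun _ => tmap E E (fun y : M => g • y) x v) = tmap E ℝ (fun y : M => f (g • y)) x v := by
      intro g hg
      rw [← (hf _ hg).2, tmap_comp (f := fun y : M => g • y) rfl (hf _ hg).1 (hgd g x)]
      rfl
    have hev : ∀ᶠ g in 𝓝 g₀, g ∈ ψ.source ∧ ψ g ∈ Metric.ball (ψ g₀) ε :=
      Filter.Eventually.and ((isOpen_extChartAt_source _).mem_nhds (mem_extChartAt_source g₀))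
        ((continuousAt_extChartAt g₀).eventually (Metric.isOpen_ball.mem_nhds
          (Metric.mem_ball_self hε)))
    filter_upwards [hev] with g hg
    have hg' := hball hg.2
    have hgW' : g ∈ W := by simpa [ψ.left_inv hg.1] using hg'.2
    rw [hder g (hWV (Set.mk_mem_prod hgW' hxV)), hder g₀ hxU]
    refine congrArg (fun l : E →L[ℝ] ℝ => l v) (tmap_congr ?_)
    filter_upwards [hV.mem_nhds hxV] with y hy
    have := hconst y hy _ hg.2
    rwa [ψ.left_inv hg.1] at this
  have h := hloc.apply_eq_of_isPreconnected isPreconnected_univ (Set.mem_univ g)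
    (Set.mem_univ (1 : G))
  refine h.trans ?_
  have e : (fun y : M => (1 : G) • y) = fun y => y := by funext y; exact one_smul G y
  rw [e, tmap_id, one_smul]
  rfl

end Invariance

/-! ### Manifold structures from families of charts -/

section Family

/-- The charted space structure given by a family of charts. -/
@[reducible] def chartedSpaceOfFamily {H X ι : Type*} [TopologicalSpace H] [TopologicalSpace X]
    (φ : ι → OpenPartialHomeomorph X H) (s : X → ι) (h : ∀ x, x ∈ (φ (s x)).source) :
    ChartedSpace H X where
  atlas := Set.range φ
  chartAt x := φ (s x)
  mem_chart_source := h
  chart_mem_atlas x := ⟨s x, rfl⟩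

theorem isManifold_chartedSpaceOfFamily {H X ι : Type*} [NormedAddCommGroup H] [NormedSpace ℝ H]
    [TopologicalSpace X] (φ : ι → OpenPartialHomeomorph X H) (s : X → ι)
    (h : ∀ x, x ∈ (φ (s x)).source)
    (hφ : ∀ i i', ∀ u ∈ (φ i).target, (φ i).symm u ∈ (φ i').source →
      ContDiffAt ℝ ∞ (fun u => φ i' ((φ i).symm u)) u) :
    letI := chartedSpaceOfFamily φ s h
    IsManifold 𝓘(ℝ, H) ∞ X := by
  let _ := chartedSpaceOfFamily φ s h
  refine isManifold_of_contDiffOn 𝓘(ℝ, H) ∞ X ?_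
  rintro _ _ ⟨i, rfl⟩ ⟨i', rfl⟩ u hu
  exact (hφ i i' u hu.1.1 hu.1.2).contDiffWithinAt

end Family

/-! ### The level set as a manifold -/

section Level

variable {E : Type*} [NormedAddCommGroup E] [NormedSpace ℝ E]
  {M : Type*} [TopologicalSpace M] [ChartedSpace E M]
  {F : Type*} [NormedAddCommGroup F] [NormedSpace ℝ F]
  {G : Type*} [TopologicalSpace G] [ChartedSpace F G] [Group G]
  [MulAction G M] {J : M → F →L[ℝ] ℝ} {μ : F →L[ℝ] ℝ} {k d : ℕ}

/-- The splitting of `ℝᵏ⁺ᵈ`. -/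
def splitting (k d : ℕ) : EuclideanSpace ℝ (Fin (k + d)) ≃L[ℝ]
    EuclideanSpace ℝ (Fin k) × EuclideanSpace ℝ (Fin d) :=
  ContinuousLinearEquiv.ofFinrankEq (by simp)

namespace AdaptedChart

variable {x₀ : M} (a : AdaptedChart E G J μ k d x₀)

include a

theorem symm_mem_level {w : EuclideanSpace ℝ (Fin k) × EuclideanSpace ℝ (Fin d)}
    (hw : ((0, w) : Coords F k d) ∈ a.Φ.target) : J (a.Φ.symm (0, w)) = μ := by
  have h := a.fst_eq _ (a.Φ.map_target hw)
  rw [a.Φ.right_inv hw] at h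
  exact (sub_eq_zero.1 h.symm)

theorem apply_eq {y : M} (hy : y ∈ a.Φ.source) (hyμ : J y = μ) : a.Φ y = (0, (a.Φ y).2) :=
  Prod.ext (by rw [a.fst_eq y hy, hyμ, sub_self]) rfl

theorem mem_target_of_mem_target {w : Coords F k d} (hw : w ∈ a.Φ.target) :
    ((0, 0, w.2.2) : Coords F k d) ∈ a.Φ.target := by
  rw [a.target_eq] at hw ⊢
  simp only [Metric.mem_ball, dist_zero_right, Prod.norm_def, max_lt_iff, norm_zero] at hw ⊢
  exact ⟨a.ε_pos, a.ε_pos, hw.2.2⟩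

theorem mdifferentiable : a.Φ.MDifferentiable 𝓘(ℝ, E) 𝓘(ℝ, Coords F k d) :=
  ⟨a.smooth.mdifferentiableOn (by simp), a.smooth_symm.mdifferentiableOn (by simp)⟩

variable (hx₀ : x₀ ∈ J ⁻¹' {μ})

open Classical in
/-- The chart of the level set induced by an adapted chart. -/
def levelChart : OpenPartialHomeomorph (J ⁻¹' {μ}) (EuclideanSpace ℝ (Fin (k + d))) where
  toFun y := (splitting k d).symm (a.Φ y).2
  -- Outside the target the value `x₀` is arbitrary and serves only to make the inverse total.
  invFun u := if h : ((0, splitting k d u) : Coords F k d) ∈ a.Φ.target then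
    ⟨a.Φ.symm (0, splitting k d u), a.symm_mem_level h⟩ else ⟨x₀, hx₀⟩
  source := Subtype.val ⁻¹' a.Φ.source
  target := {u | ((0, splitting k d u) : Coords F k d) ∈ a.Φ.target}
  map_source' y hy := by
    have := a.Φ.map_source hy
    rw [a.apply_eq hy y.2] at this
    simpa using this
  map_target' u hu := by
    simp only [Set.mem_ofPred_eq] at hu
    simp only [Set.mem_preimage, hu, dite_true]
    exact a.Φ.map_target hu
  left_inv' y hy := by
    have h : ((0, splitting k d ((splitting k d).symm (a.Φ y).2)) : Coords F k d) ∈ a.Φ.target := by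
      have := a.Φ.map_source hy
      rw [a.apply_eq hy y.2] at this
      simpa using this
    rw [dif_pos h]
    refine Subtype.ext ?_
    change a.Φ.symm _ = y.1
    rw [ContinuousLinearEquiv.apply_symm_apply, ← a.apply_eq hy y.2, a.Φ.left_inv hy]
  right_inv' u hu := by
    simp only [Set.mem_ofPred_eq] at hu
    rw [dif_pos hu, a.Φ.right_inv hu, ContinuousLinearEquiv.symm_apply_apply]
  open_source := a.Φ.open_source.preimage continuous_subtype_val
  open_target := a.Φ.open_target.preimage (by fun_prop)
  continuousOn_toFun := by
    refine (splitting k d).symm.continuous.comp_continuousOn (continuous_snd.comp_continuousOn ?_)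
    exact a.Φ.continuousOn.comp continuous_subtype_val.continuousOn fun y hy => hy
  continuousOn_invFun := by
    rw [Topology.IsInducing.subtypeVal.continuousOn_iff]
    have h : ContinuousOn (fun u => a.Φ.symm ((0, splitting k d u) : Coords F k d))
        {u | ((0, splitting k d u) : Coords F k d) ∈ a.Φ.target} :=
      a.Φ.symm.continuousOn.comp (Continuous.continuousOn (by fun_prop)) fun u hu => hu
    refine h.congr fun u hu => ?_
    simp only [Set.mem_ofPred_eq] at hu
    simp [hu]

theorem levelChart_symm_val {u : EuclideanSpace ℝ (Fin (k + d))}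
    (hu : u ∈ (a.levelChart hx₀).target) :
    ((a.levelChart hx₀).symm u : M) = a.Φ.symm (0, splitting k d u) := by
  change ((a.levelChart hx₀).invFun u : M) = _
  have hu' : ((0, splitting k d u) : Coords F k d) ∈ a.Φ.target := hu
  simp [levelChart, hu']

end AdaptedChart

variable (a : ∀ x : J ⁻¹' {μ}, AdaptedChart E G J μ k d x.1)

/-- The charted space structure on the level set induced by adapted charts. -/
@[reducible] def levelChartedSpace :
    ChartedSpace (EuclideanSpace ℝ (Fin (k + d))) (J ⁻¹' {μ}) :=
  chartedSpaceOfFamily (fun x => (a x).levelChart x.2) id fun x => (a x).mem_source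

theorem contDiff_inclusion :
    ContDiff ℝ ∞ fun u : EuclideanSpace ℝ (Fin (k + d)) => ((0, splitting k d u) : Coords F k d) :=
  contDiff_const.prodMk (splitting k d).contDiff

theorem contDiff_splitting_symm_snd :
    ContDiff ℝ ∞ fun w : Coords F k d => (splitting k d).symm w.2 :=
  (splitting k d).symm.contDiff.comp contDiff_snd

theorem isManifold_level :
    letI := levelChartedSpace a
    IsManifold 𝓘(ℝ, EuclideanSpace ℝ (Fin (k + d))) ∞ (J ⁻¹' {μ}) := by
  refine isManifold_chartedSpaceOfFamily _ _ _ fun x x' u hu hu' => ?_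
  have hu₁ : ((0, splitting k d u) : Coords F k d) ∈ (a x).Φ.target := hu
  have hu₂ : (a x).Φ.symm (0, splitting k d u) ∈ (a x').Φ.source := by
    rw [← (a x).levelChart_symm_val x.2 hu]; exact hu'
  have h1 : ContMDiffAt 𝓘(ℝ, EuclideanSpace ℝ (Fin (k + d)))
      𝓘(ℝ, EuclideanSpace ℝ (Fin (k + d))) ∞ (fun u => (splitting k d).symm
        ((a x').Φ ((a x).Φ.symm ((0, splitting k d u) : Coords F k d))).2) u :=
    contDiff_splitting_symm_snd.contMDiff.contMDiffAt.comp u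
      (((a x').smooth.contMDiffAt ((a x').Φ.open_source.mem_nhds hu₂)).comp u
        (((a x).smooth_symm.contMDiffAt ((a x).Φ.open_target.mem_nhds hu₁)).comp u
          contDiff_inclusion.contMDiff.contMDiffAt))
  refine h1.contDiffAt.congr_of_eventuallyEq ?_
  filter_upwards [((a x).levelChart x.2).open_target.mem_nhds hu] with v hv
  change (splitting k d).symm ((a x').Φ (((a x).levelChart x.2).symm v : M)).2 = _
  rw [(a x).levelChart_symm_val x.2 hv]

/-- The inclusion of the level set is smooth. -/
theorem contMDiff_level_val :
    letI := levelChartedSpace a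
    ContMDiff 𝓘(ℝ, EuclideanSpace ℝ (Fin (k + d))) 𝓘(ℝ, E) ∞ (Subtype.val : J ⁻¹' {μ} → M) := by
  let _ := levelChartedSpace a
  have := isManifold_level a
  intro x
  have h1 : ContMDiffAt 𝓘(ℝ, EuclideanSpace ℝ (Fin (k + d))) 𝓘(ℝ, EuclideanSpace ℝ (Fin (k + d))) ∞
      ((a x).levelChart x.2) x :=
    contMDiffAt_of_mem_maximalAtlas (IsManifold.chart_mem_maximalAtlas x) (a x).mem_source
  have hu : ((0, splitting k d ((a x).levelChart x.2 x)) : Coords F k d) ∈ (a x).Φ.target :=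
    ((a x).levelChart x.2).map_source (a x).mem_source
  have h2 : ContMDiffAt 𝓘(ℝ, EuclideanSpace ℝ (Fin (k + d))) 𝓘(ℝ, E) ∞
      (fun u => (a x).Φ.symm ((0, splitting k d u) : Coords F k d)) ((a x).levelChart x.2 x) :=
    ((a x).smooth_symm.contMDiffAt ((a x).Φ.open_target.mem_nhds hu)).comp
      ((a x).levelChart x.2 x) contDiff_inclusion.contMDiff.contMDiffAt
  refine (h2.comp x h1).congr_of_eventuallyEq ?_
  filter_upwards [((a x).levelChart x.2).open_source.mem_nhds (a x).mem_source] with y hy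
  simp only [Function.comp_apply]
  rw [← (a x).levelChart_symm_val x.2 (((a x).levelChart x.2).map_source hy),
    ((a x).levelChart x.2).left_inv hy]

/-- A map into the level set is smooth if it is smooth as a map into `M`. -/
theorem contMDiffAt_level {V X : Type*} [NormedAddCommGroup V] [NormedSpace ℝ V]
    [TopologicalSpace X] [ChartedSpace V X] {f : X → J ⁻¹' {μ}} {x : X}
    (hf : ContMDiffAt 𝓘(ℝ, V) 𝓘(ℝ, E) ∞ (fun z => (f z : M)) x) :
    letI := levelChartedSpace a
    ContMDiffAt 𝓘(ℝ, V) 𝓘(ℝ, EuclideanSpace ℝ (Fin (k + d))) ∞ f x := by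
  let _ := levelChartedSpace a
  rw [contMDiffAt_iff_target]
  refine ⟨Topology.IsInducing.subtypeVal.continuousAt_iff.2 hf.continuousAt, ?_⟩
  exact contDiff_splitting_symm_snd.contMDiff.contMDiffAt.comp x
    (((a (f x)).smooth.contMDiffAt ((a (f x)).Φ.open_source.mem_nhds (a (f x)).mem_source)).comp x
      hf)

end Level

/-! ### The embedding of the level set and its tangent spaces -/

section LevelEmbedding

variable {E : Type*} [NormedAddCommGroup E] [NormedSpace ℝ E] [FiniteDimensional ℝ E]
  {M : Type*} [TopologicalSpace M] [ChartedSpace E M] [IsManifold 𝓘(ℝ, E) ∞ M]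
  {F : Type*} [NormedAddCommGroup F] [NormedSpace ℝ F] [FiniteDimensional ℝ F]
  {G : Type*} [TopologicalSpace G] [ChartedSpace F G] [Group G]
  [MulAction G M] {J : M → F →L[ℝ] ℝ} {μ : F →L[ℝ] ℝ} {k d : ℕ}

theorem finrank_continuousDual (F : Type*) [NormedAddCommGroup F] [NormedSpace ℝ F]
    [FiniteDimensional ℝ F] : Module.finrank ℝ (F →L[ℝ] ℝ) = Module.finrank ℝ F := by
  rw [← (LinearMap.toContinuousLinearMap (𝕜 := ℝ) (E := F) (F' := ℝ)).finrank_eq]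
  exact Subspace.dual_finrank_eq

/-- In an adapted chart the inclusion is `(b, c) ↦ (0, b, c)`. The dimension formula comes from a
point of the level set, hence the condition that there be one. -/
theorem isSmoothEmbedding_level (a : ∀ x : J ⁻¹' {μ}, AdaptedChart E G J μ k d x.1)
    (hd : Nonempty (J ⁻¹' {μ}) → Module.finrank ℝ E = Module.finrank ℝ F + k + d) :
    letI := levelChartedSpace a
    Manifold.IsSmoothEmbedding 𝓘(ℝ, EuclideanSpace ℝ (Fin (k + d))) 𝓘(ℝ, E) ∞
      (Subtype.val : J ⁻¹' {μ} → M) := by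
  let _ := levelChartedSpace a
  have := isManifold_level a
  have hfd := finrank_continuousDual F
  let D : EuclideanSpace ℝ (Fin (Module.finrank ℝ F)) ≃L[ℝ] (F →L[ℝ] ℝ) :=
    ContinuousLinearEquiv.ofFinrankEq (by simp [hfd])
  refine ⟨Manifold.IsImmersionOfComplement.isImmersion
    (F := EuclideanSpace ℝ (Fin (Module.finrank ℝ F))) fun x => ?_, Topology.IsEmbedding.subtypeVal⟩
  let L : Coords F k d ≃L[ℝ] E := ContinuousLinearEquiv.ofFinrankEq (by
    simp only [Module.finrank_prod, finrank_euclideanSpace_fin]; have := hd ⟨x⟩; omega)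
  let e : (EuclideanSpace ℝ (Fin (k + d)) × EuclideanSpace ℝ (Fin (Module.finrank ℝ F))) ≃L[ℝ] E :=
    (((splitting k d).prodCongr D).trans (ContinuousLinearEquiv.prodComm ℝ _ _)).trans L
  let Ψ : OpenPartialHomeomorph M E := (a x).Φ.transHomeomorph L.toHomeomorph
  refine Manifold.IsImmersionAtOfComplement.mk_of_charts e ((a x).levelChart x.2) Ψ
    (a x).mem_source (a x).mem_source (IsManifold.chart_mem_maximalAtlas x) ?_ ?_ ?_
  · refine OpenPartialHomeomorph.mem_maximalAtlas_of_contMDiffOn Ψ ?_ ?_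
    · exact L.contDiff.contMDiff.comp_contMDiffOn (a x).smooth
    · exact (a x).smooth_symm.comp L.symm.contDiff.contMDiff.contMDiffOn fun y hy => hy
  · exact fun y hy => hy
  · intro u hu
    have hu' : u ∈ ((a x).levelChart x.2).target := by simpa using hu
    have hu'' : ((0, splitting k d u) : Coords F k d) ∈ (a x).Φ.target := hu'
    change L ((a x).Φ (((a x).levelChart x.2).symm u : M)) = L (D 0, splitting k d u)
    rw [(a x).levelChart_symm_val x.2 hu', (a x).Φ.right_inv hu'', map_zero]

omit [IsManifold 𝓘(ℝ, E) ∞ M] in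
/-- The tangent spaces of the level set are the kernels of the differential of `J`. -/
theorem tmap_level_val (a : ∀ x : J ⁻¹' {μ}, AdaptedChart E G J μ k d x.1)
    (hJ : ContMDiff 𝓘(ℝ, E) 𝓘(ℝ, F →L[ℝ] ℝ) ∞ J) (x : J ⁻¹' {μ})
    (hsurj : Function.Surjective (tmap E (F →L[ℝ] ℝ) J x))
    (hd : Module.finrank ℝ E = Module.finrank ℝ F + k + d) :
    letI := levelChartedSpace a
    (tmap (EuclideanSpace ℝ (Fin (k + d))) E (Subtype.val : J ⁻¹' {μ} → M) x).range =
      (tmap E (F →L[ℝ] ℝ) J x).ker := by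
  let _ := levelChartedSpace a
  have := isManifold_level a
  set V := EuclideanSpace ℝ (Fin (k + d))
  have hv : MDifferentiableAt 𝓘(ℝ, V) 𝓘(ℝ, E) (Subtype.val : J ⁻¹' {μ} → M) x :=
    (contMDiff_level_val a x).mdifferentiableAt (by simp)
  have hJd : MDifferentiableAt 𝓘(ℝ, E) 𝓘(ℝ, F →L[ℝ] ℝ) J x :=
    (hJ x).mdifferentiableAt (by simp)
  -- The level chart has injective differential and factors through the inclusion.
  have hinj : Function.Injective (tmap V E (Subtype.val : J ⁻¹' {μ} → M) x) := by
    have h1 := tmap_comp rfl ((a x).mdifferentiable.mdifferentiableAt (a x).mem_source) hv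
    have h2 := tmap_hasFDerivAt_comp (g := fun w : Coords F k d => (splitting k d).symm w.2)
      (contDiff_splitting_symm_snd.contDiffAt.differentiableAt (by simp)).hasFDerivAt
      (((a x).mdifferentiable.mdifferentiableAt (a x).mem_source).comp x hv)
    have h3 : Function.Injective (tmap V V ((a x).levelChart x.2) x) :=
      (mdifferentiable_chart (I := 𝓘(ℝ, V)) x).mfderiv_injective (a x).mem_source
    have h4 : tmap V V ((a x).levelChart x.2) x = _ := h2
    rw [h4] at h3
    have h5 : Function.Injective (tmap V (Coords F k d)
      ((a x).Φ ∘ (Subtype.val : J ⁻¹' {μ} → M)) x) := Function.Injective.of_comp h3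
    have h6 : tmap V (Coords F k d) ((a x).Φ ∘ (Subtype.val : J ⁻¹' {μ} → M)) x = _ := h1
    rw [h6] at h5
    exact Function.Injective.of_comp h5
  refine Submodule.eq_of_le_of_finrank_eq ?_ ?_
  · rintro _ ⟨v, rfl⟩
    have h1 := tmap_comp rfl hJd hv
    have h2 : (fun y : J ⁻¹' {μ} => J y) = fun _ => μ := funext fun y => y.2
    rw [h2, tmap_const] at h1
    exact (congrArg (fun l : V →L[ℝ] (F →L[ℝ] ℝ) => l v) h1).symm
  · have h1 := LinearMap.finrank_range_add_finrank_ker (tmap E (F →L[ℝ] ℝ) J x).toLinearMap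
    rw [LinearMap.range_eq_top.2 hsurj, finrank_top, finrank_continuousDual] at h1
    have h2 := LinearMap.finrank_range_of_inj
      (f := (tmap V E (Subtype.val : J ⁻¹' {μ} → M) x).toLinearMap) hinj
    rw [finrank_euclideanSpace_fin] at h2
    change Module.finrank ℝ (tmap V E (Subtype.val : J ⁻¹' {μ} → M) x).toLinearMap.range =
      Module.finrank ℝ (tmap E (F →L[ℝ] ℝ) J x).toLinearMap.ker
    omega

end LevelEmbedding

/-! ### The reduced space as a manifold -/

section Reduced

variable {E : Type*} [NormedAddCommGroup E] [NormedSpace ℝ E]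
  {M : Type*} [TopologicalSpace M] [ChartedSpace E M]
  {F : Type*} [NormedAddCommGroup F] [NormedSpace ℝ F]
  {G : Type*} [TopologicalSpace G] [ChartedSpace F G] [Group G] [LieGroup 𝓘(ℝ, F) ∞ G]
  [MulAction G M]
  {J : M → F →L[ℝ] ℝ} {μ : F →L[ℝ] ℝ} {k d : ℕ}

omit [TopologicalSpace M] in
theorem mem_isotropy_of_smul_mem (hJ : ∀ (g : G) (x : M), J (g • x) = Coad g (J x)) {g : G} {x : M}
    (hx : J x = μ) (hgx : J (g • x) = μ) : g ∈ isotropy G μ := by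
  rw [hJ, hx] at hgx
  exact hgx

omit [TopologicalSpace M] in
theorem smul_mem_level (hJ : ∀ (g : G) (x : M), J (g • x) = Coad g (J x)) {g : G}
    (hg : g ∈ isotropy G μ) {x : M} (hx : J x = μ) : J (g • x) = μ := by
  rw [hJ, hx]
  exact hg

-- If `g` carries one point of `J⁻¹(μ)` to another, equivariance forces `Coad g μ = μ`. This lets
-- `G`-orbits replace `G_μ`-orbits everywhere.
omit [TopologicalSpace M] in
theorem reducedProj_eq_iff (hJ : ∀ (g : G) (x : M), J (g • x) = Coad g (J x))
    (y y' : J ⁻¹' {μ}) : reducedProj G J μ y = reducedProj G J μ y' ↔ ∃ g : G, g • y.1 = y'.1 := by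
  have h : reducedProj G J μ y = reducedProj G J μ y' ↔
      y.1 ∈ MulAction.orbit (isotropy G μ) y'.1 := Quotient.eq
  rw [h]
  constructor
  · rintro ⟨g, hg⟩
    refine ⟨(g : G)⁻¹, ?_⟩
    rw [← hg]
    exact inv_smul_smul (g : G) y'.1
  · rintro ⟨g, hg⟩
    have hg' : g ∈ isotropy G μ := mem_isotropy_of_smul_mem hJ y.2 (by rw [hg]; exact y'.2)
    refine ⟨⟨g, hg'⟩⁻¹, ?_⟩
    change g⁻¹ • y'.1 = y.1
    rw [← hg, inv_smul_smul]

theorem isOpenQuotientMap_reducedProj [ContinuousConstSMul G M]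
    (hJ : ∀ (g : G) (x : M), J (g • x) = Coad g (J x)) :
    IsOpenQuotientMap (reducedProj G J μ : J ⁻¹' {μ} → ReducedSpace G J μ) := by
  refine ⟨Quotient.mk_surjective, continuous_quotient_mk', fun U hU => ?_⟩
  -- The saturation of an open set is a union of preimages under translations by `G_μ`, hence open.
  have h : reducedProj G J μ ⁻¹' (reducedProj G J μ '' U) =
      ⋃ g : isotropy G μ, (fun y : J ⁻¹' {μ} =>
        (⟨(g : G) • y.1, smul_mem_level hJ g.2 y.2⟩ : J ⁻¹' {μ})) ⁻¹' U := by
    ext y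
    simp only [Set.mem_preimage, Set.mem_image, Set.mem_iUnion]
    constructor
    · rintro ⟨y', hy', h⟩
      obtain ⟨g, hg⟩ := (reducedProj_eq_iff hJ y y').1 h.symm
      refine ⟨⟨g, mem_isotropy_of_smul_mem hJ y.2 (by rw [hg]; exact y'.2)⟩, ?_⟩
      have e : y' = ⟨g • y.1, by rw [hg]; exact y'.2⟩ := Subtype.ext hg.symm
      rw [e] at hy'
      exact hy'
    · rintro ⟨g, hg⟩
      exact ⟨_, hg, ((reducedProj_eq_iff hJ _ _).2 ⟨g, rfl⟩).symm⟩
  change IsOpen (reducedProj G J μ ⁻¹' (reducedProj G J μ '' U))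
  rw [h]
  exact isOpen_iUnion fun g => hU.preimage
    (Continuous.subtype_mk ((continuous_const_smul (g : G)).comp continuous_subtype_val) _)

/-- `M_μ` maps continuously and injectively to `M / G`, which is Hausdorff because the action is
proper. -/
theorem t2Space_reducedSpace [ProperSMul G M]
    (hJ : ∀ (g : G) (x : M), J (g • x) = Coad g (J x)) : T2Space (ReducedSpace G J μ) := by
  have : IsTopologicalGroup G := topologicalGroup_of_lieGroup 𝓘(ℝ, F) ∞
  let f : ReducedSpace G J μ → Quotient (MulAction.orbitRel G M) :=
    Quotient.lift (fun y : J ⁻¹' {μ} => (Quotient.mk (MulAction.orbitRel G M) y.1)) (by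
      rintro y y' ⟨g, hg⟩
      exact Quotient.sound ⟨(g : G), hg⟩)
  refine T2Space.of_injective_continuous (f := f) ?_ ?_
  · rintro ⟨y⟩ ⟨y'⟩ h
    obtain ⟨g, hg⟩ := Quotient.exact h
    exact ((reducedProj_eq_iff hJ y' y).2 ⟨g, hg⟩).symm
  · exact Continuous.quotient_lift (continuous_quotient_mk'.comp continuous_subtype_val) _

namespace AdaptedChart

variable {x₀ : M} (a : AdaptedChart E G J μ k d x₀) (hx₀ : x₀ ∈ J ⁻¹' {μ})

/-- The local section of the projection to the reduced space given by an adapted chart. -/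
def section' (c : EuclideanSpace ℝ (Fin d)) : J ⁻¹' {μ} :=
  (a.levelChart hx₀).symm ((splitting k d).symm (0, c))

omit [LieGroup 𝓘(ℝ, F) ∞ G] in
theorem section'_val {c : EuclideanSpace ℝ (Fin d)}
    (hc : ((0, 0, c) : Coords F k d) ∈ a.Φ.target) :
    (a.section' hx₀ c : M) = a.Φ.symm (0, 0, c) := by
  have := a.levelChart_symm_val hx₀ (u := (splitting k d).symm (0, c)) (by
    change ((0, splitting k d _) : Coords F k d) ∈ a.Φ.target
    simpa using hc)
  rw [section', this, ContinuousLinearEquiv.apply_symm_apply]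

open Classical in
/-- The function on the reduced space induced by the last component of an adapted chart. -/
def redFun (z : ReducedSpace G J μ) : EuclideanSpace ℝ (Fin d) :=
  -- The choice of representative is immaterial by `rel`; the value `0` lies outside the domain of
  -- the chart.
  if h : ∃ y : J ⁻¹' {μ}, y.1 ∈ a.Φ.source ∧ reducedProj G J μ y = z then (a.Φ h.choose).2.2 else 0

variable (hJ : ∀ (g : G) (x : M), J (g • x) = Coad g (J x))

include hJ in
theorem redFun_reducedProj {y : J ⁻¹' {μ}} (hy : y.1 ∈ a.Φ.source) :
    a.redFun (reducedProj G J μ y) = (a.Φ y).2.2 := by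
  have h : ∃ y' : J ⁻¹' {μ}, y'.1 ∈ a.Φ.source ∧ reducedProj G J μ y' = reducedProj G J μ y :=
    ⟨y, hy, rfl⟩
  rw [redFun, dif_pos h]
  have hs := h.choose_spec
  exact (a.rel _ hs.1 _ hy h.choose.2 y.2).2 ((reducedProj_eq_iff hJ _ _).1 hs.2)

/-- The chart of the reduced space induced by an adapted chart. -/
def redChart [ContinuousConstSMul G M] :
    OpenPartialHomeomorph (ReducedSpace G J μ) (EuclideanSpace ℝ (Fin d)) where
  toFun := a.redFun
  invFun c := reducedProj G J μ (a.section' hx₀ c)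
  source := reducedProj G J μ '' (Subtype.val ⁻¹' a.Φ.source)
  target := {c | ((0, 0, c) : Coords F k d) ∈ a.Φ.target}
  map_source' := by
    rintro _ ⟨y, hy, rfl⟩
    rw [a.redFun_reducedProj hJ hy]
    exact a.mem_target_of_mem_target (a.Φ.map_source hy)
  map_target' c hc := by
    refine ⟨_, ?_, rfl⟩
    rw [Set.mem_preimage, a.section'_val hx₀ hc]
    exact a.Φ.map_target hc
  left_inv' := by
    rintro _ ⟨y, hy, rfl⟩
    rw [a.redFun_reducedProj hJ hy, reducedProj_eq_iff hJ]
    have hc := a.mem_target_of_mem_target (a.Φ.map_source hy)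
    have hs := a.section'_val hx₀ hc
    have hm : (a.section' hx₀ (a.Φ y).2.2 : M) ∈ a.Φ.source := by
      rw [hs]; exact a.Φ.map_target hc
    refine (a.rel _ hm _ hy (a.section' hx₀ _).2 y.2).1 ?_
    rw [hs, a.Φ.right_inv hc]
  right_inv' c hc := by
    have hs := a.section'_val hx₀ hc
    have hm : (a.section' hx₀ c : M) ∈ a.Φ.source := by
      rw [hs]; exact a.Φ.map_target hc
    rw [a.redFun_reducedProj hJ hm, hs, a.Φ.right_inv hc]
  open_source := (isOpenQuotientMap_reducedProj hJ).isOpenMap _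
    (a.Φ.open_source.preimage continuous_subtype_val)
  open_target := a.Φ.open_target.preimage (by fun_prop)
  continuousOn_toFun := by
    rintro _ ⟨y, hy, rfl⟩
    refine ContinuousAt.continuousWithinAt ?_
    rw [← (isOpenQuotientMap_reducedProj hJ).continuousAt_comp_iff]
    have h1 : ContinuousAt (fun y : J ⁻¹' {μ} => (a.Φ y).2.2) y := by
      have : ContinuousAt (fun y : J ⁻¹' {μ} => a.Φ y) y :=
        (a.Φ.continuousAt hy).comp continuous_subtype_val.continuousAt
      exact this.snd.snd
    refine h1.congr ?_
    filter_upwards [(a.Φ.open_source.preimage continuous_subtype_val).mem_nhds hy] with y' hy'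
    exact (a.redFun_reducedProj hJ hy').symm
  continuousOn_invFun := by
    refine (isOpenQuotientMap_reducedProj hJ).continuous.comp_continuousOn ?_
    refine (a.levelChart hx₀).symm.continuousOn.comp (Continuous.continuousOn (by fun_prop)) ?_
    intro c hc
    change ((0, splitting k d _) : Coords F k d) ∈ a.Φ.target
    simpa using hc

end AdaptedChart

variable [ContMDiffSMul 𝓘(ℝ, F) 𝓘(ℝ, E) ∞ G M] [ContinuousConstSMul G M]
  (hJ : ∀ (g : G) (x : M), J (g • x) = Coad g (J x))
  (a : ∀ x : J ⁻¹' {μ}, AdaptedChart E G J μ k d x.1)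

/-- The charted space structure on the reduced space induced by adapted charts. -/
@[reducible] def reducedChartedSpace :
    ChartedSpace (EuclideanSpace ℝ (Fin d)) (ReducedSpace G J μ) :=
  chartedSpaceOfFamily (fun x => (a x).redChart x.2 hJ) Quotient.out fun z =>
    ⟨z.out, (a z.out).mem_source, z.out_eq⟩

omit [LieGroup 𝓘(ℝ, F) ∞ G] [ContMDiffSMul 𝓘(ℝ, F) 𝓘(ℝ, E) ∞ G M] [ContinuousConstSMul G M] in
theorem AdaptedChart.contMDiffOn_section {x₀ : M} (a : AdaptedChart E G J μ k d x₀)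
    (hx₀ : x₀ ∈ J ⁻¹' {μ}) : ContMDiffOn 𝓘(ℝ, EuclideanSpace ℝ (Fin d)) 𝓘(ℝ, E) ∞
      (fun c => (a.section' hx₀ c : M)) {c | ((0, 0, c) : Coords F k d) ∈ a.Φ.target} := by
  have h1 : ContMDiff 𝓘(ℝ, EuclideanSpace ℝ (Fin d)) 𝓘(ℝ, Coords F k d) ∞
      (fun c : EuclideanSpace ℝ (Fin d) => ((0, 0, c) : Coords F k d)) :=
    (contDiff_const.prodMk (contDiff_const.prodMk contDiff_id)).contMDiff
  refine (a.smooth_symm.comp h1.contMDiffOn fun c hc => hc).congr fun c hc => ?_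
  exact a.section'_val hx₀ hc

/-- A transition map lifts to the section of one chart, translation by a group element, and the last
component of the other chart. One fixed `g ∈ G_μ`, chosen at the base point, works nearby, so no
smooth dependence of `g` is needed. -/
theorem isManifold_reduced :
    letI := reducedChartedSpace hJ a
    IsManifold 𝓘(ℝ, EuclideanSpace ℝ (Fin d)) ∞ (ReducedSpace G J μ) := by
  refine isManifold_chartedSpaceOfFamily _ _ _ fun x x' c hc hc' => ?_
  set A := a x
  set A' := a x'
  obtain ⟨y', hy', he⟩ := hc'
  obtain ⟨g, hg⟩ := (reducedProj_eq_iff hJ (A.section' x.2 c) y').1 he.symm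
  have hgμ : g ∈ isotropy G μ :=
    mem_isotropy_of_smul_mem hJ (A.section' x.2 c).2 (by rw [hg]; exact y'.2)
  have hT : IsOpen {c | ((0, 0, c) : Coords F k d) ∈ A.Φ.target} :=
    (A.redChart x.2 hJ).open_target
  have h1 : ContMDiffAt 𝓘(ℝ, EuclideanSpace ℝ (Fin d)) 𝓘(ℝ, E) ∞
      (fun c => g • (A.section' x.2 c : M)) c :=
    (ContMDiffSMul.contMDiff_const_smul (I := 𝓘(ℝ, F)) (n := ∞) g).contMDiffAt.comp c
      ((A.contMDiffOn_section x.2).contMDiffAt (hT.mem_nhds hc))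
  have hy'' : g • (A.section' x.2 c : M) ∈ A'.Φ.source := by rw [hg]; exact hy'
  have hs : ContDiff ℝ ∞ fun w : Coords F k d => w.2.2 := contDiff_snd.comp contDiff_snd
  have h2 : ContMDiffAt 𝓘(ℝ, EuclideanSpace ℝ (Fin d)) 𝓘(ℝ, EuclideanSpace ℝ (Fin d)) ∞
      (fun c => (A'.Φ (g • (A.section' x.2 c : M))).2.2) c :=
    hs.contMDiff.contMDiffAt.comp c
      ((A'.smooth.contMDiffAt (A'.Φ.open_source.mem_nhds hy'')).comp c h1)
  refine h2.contDiffAt.congr_of_eventuallyEq ?_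
  filter_upwards [h1.continuousAt (A'.Φ.open_source.mem_nhds hy'')] with c' hc'
  have h3 := A'.redFun_reducedProj hJ
    (y := ⟨g • (A.section' x.2 c' : M), smul_mem_level hJ hgμ (A.section' x.2 c').2⟩) hc'
  refine Eq.trans ?_ h3
  change A'.redFun (reducedProj G J μ (A.section' x.2 c')) = _
  exact congrArg _ ((reducedProj_eq_iff hJ _ _).2 ⟨g, rfl⟩)

end Reduced

/-! ### Kernels of alternating forms -/

section FormKer

theorem mem_formKer {V : Type*} [AddCommGroup V] [Module ℝ V] [TopologicalSpace V] {k : ℕ}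
    {α : V [⋀^Fin (k + 1)]→L[ℝ] ℝ} {v : V} :
    v ∈ formKer α ↔ ∀ w : Fin k → V, α (Matrix.vecCons v w) = 0 := Iff.rfl

/-- A transposition brings the kernel vector to the first slot and changes at most the sign. -/
theorem apply_eq_zero_of_mem_formKer {V : Type*} [AddCommGroup V] [Module ℝ V]
    [TopologicalSpace V] {k : ℕ} {α : V [⋀^Fin (k + 1)]→L[ℝ] ℝ} {u : Fin (k + 1) → V}
    {i : Fin (k + 1)} (h : u i ∈ formKer α) : α u = 0 := by
  have h1 := α.toAlternatingMap.map_perm u (Equiv.swap 0 i)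
  have h2 : u ∘ Equiv.swap 0 i = Matrix.vecCons (u i) (Matrix.vecTail (u ∘ Equiv.swap 0 i)) := by
    funext j
    refine Fin.cases ?_ (fun j => ?_) j
    · simp
    · rfl
  rw [h2] at h1
  have h3 : α.toAlternatingMap (Matrix.vecCons (u i) (Matrix.vecTail (u ∘ Equiv.swap 0 i))) = 0 :=
    h _
  rw [h3] at h1
  exact (smul_eq_zero_iff_eq _).1 h1.symm

theorem apply_eq_of_sub_mem_formKer {V : Type*} [AddCommGroup V] [Module ℝ V]
    [TopologicalSpace V] {k : ℕ} {α : V [⋀^Fin (k + 1)]→L[ℝ] ℝ} {v v' : Fin (k + 1) → V}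
    (h : ∀ i, v' i - v i ∈ formKer α) : α v' = α v := by
  classical
  -- The entries are replaced one at a time; `s` is the set of those already replaced.
  have key : ∀ s : Finset (Fin (k + 1)), α (s.piecewise v' v) = α v := by
    intro s
    induction s using Finset.induction_on with
    | empty => simp
    | insert i s hi ih =>
      rw [← ih, Finset.piecewise_insert, ← sub_eq_zero]
      set u := s.piecewise v' v with hu
      have h1 : u = Function.update u i (v i) := by
        have : v i = u i := by simp [hu, hi]
        rw [this, Function.update_eq_self]
      have h2 : α (Function.update u i (v' i - v i)) = 0 :=
        apply_eq_zero_of_mem_formKer (i := i) (by simpa using h i)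
      rw [α.map_update_sub, ← h1] at h2
      exact h2
  simpa using key Finset.univ

end FormKer

/-! ### Descent of forms along a surjective submersion -/

section Descent

variable {V W E : Type*} [NormedAddCommGroup V] [NormedSpace ℝ V]
  [NormedAddCommGroup W] [NormedSpace ℝ W] [NormedAddCommGroup E] [NormedSpace ℝ E]
  {S Q M : Type*} [TopologicalSpace S] [ChartedSpace V S]
  [TopologicalSpace Q] [ChartedSpace W Q] [TopologicalSpace M] [ChartedSpace E M] {k : ℕ}

theorem pullback_comp {f : S → Q} {g : Q → M} {x : S} (α : DiffForm E M k)
    (hg : MDifferentiableAt 𝓘(ℝ, W) 𝓘(ℝ, E) g (f x)) (hf : MDifferentiableAt 𝓘(ℝ, V) 𝓘(ℝ, W) f x) :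
    DiffForm.pullback (E := V) (fun z => g (f z)) α x =
      DiffForm.pullback (E := V) f (DiffForm.pullback (E := W) g α) x := by
  ext v
  refine (pullback_apply (V := V) (fun z => g (f z)) α x v).trans ?_
  rw [tmap_comp rfl hg hf]
  rfl

/-- Every tangent vector of the base lifts, so the comparison is pointwise. Uniqueness thus holds
among all forms, smooth or not. -/
theorem pullback_injective {p : S → Q} (hp : Function.Surjective p)
    (hp' : ∀ x, Function.Surjective (tmap V W p x)) {α β : DiffForm W Q k}
    (h : DiffForm.pullback (E := V) p α = DiffForm.pullback (E := V) p β) : α = β := by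
  funext z
  obtain ⟨x, rfl⟩ := hp z
  refine ContinuousAlternatingMap.ext fun w => ?_
  choose v hv using fun i => hp' x (w i)
  have h1 := congrArg (fun l : V [⋀^Fin k]→L[ℝ] ℝ => l v) (congrFun h x)
  have h2 : (fun i => tmap V W p x (v i)) = w := funext hv
  have h3 : (α (p x) : W [⋀^Fin k]→L[ℝ] ℝ) (fun i => tmap V W p x (v i)) =
    (β (p x) : W [⋀^Fin k]→L[ℝ] ℝ) (fun i => tmap V W p x (v i)) := h1
  rwa [h2] at h3

/-- A form descends along a surjective submersion if its value depends only on the images of the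
base point and of the tangent vectors. -/
theorem exists_pullback_eq [FiniteDimensional ℝ W] {p : S → Q} (hp : Function.Surjective p)
    (hp' : ∀ x, Function.Surjective (tmap V W p x)) (β : DiffForm V S k)
    (hβ : ∀ x x', p x = p x' → ∀ v v' : Fin k → V,
      (∀ i, tmap V W p x (v i) = tmap V W p x' (v' i)) →
      (β x : V [⋀^Fin k]→L[ℝ] ℝ) v = (β x' : V [⋀^Fin k]→L[ℝ] ℝ) v') :
    ∃ α : DiffForm W Q k, DiffForm.pullback (E := V) p α = β := by
  choose s hs using hp
  have hR : ∀ x, ∃ R : W →L[ℝ] V, ∀ w, tmap V W p x (R w) = w := fun x => by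
    obtain ⟨R, hR⟩ := (tmap V W p x).toLinearMap.exists_rightInverse_of_surjective
      (LinearMap.range_eq_top.2 (hp' x))
    exact ⟨LinearMap.toContinuousLinearMap R, fun w => LinearMap.congr_fun hR w⟩
  choose R hR using hR
  -- Neither `s` nor `R` is claimed to be continuous; smoothness of the descended form is obtained
  -- separately from local sections.
  refine ⟨fun z => (β (s z) : V [⋀^Fin k]→L[ℝ] ℝ).compContinuousLinearMap (R (s z)), ?_⟩
  funext x
  refine ContinuousAlternatingMap.ext fun v => ?_
  exact hβ _ _ (hs _) _ _ fun i => hR _ _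

end Descent

/-! ### Linear cosymplectic reduction -/

section Pointwise

theorem mem_formKer_one {V : Type*} [AddCommGroup V] [Module ℝ V] [TopologicalSpace V]
    {α : V [⋀^Fin 1]→L[ℝ] ℝ} {v : V} : v ∈ formKer α ↔ α ![v] = 0 :=
  ⟨fun h => h ![], fun h w => by rw [Subsingleton.elim w ![]]; exact h⟩

theorem mem_formKer_two {V : Type*} [AddCommGroup V] [Module ℝ V] [TopologicalSpace V]
    {α : V [⋀^Fin 2]→L[ℝ] ℝ} {v : V} : v ∈ formKer α ↔ ∀ w, α ![v, w] = 0 := by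
  refine ⟨fun h w => h ![w], fun h w => ?_⟩
  have : w = ![w 0] := by
    funext j
    rw [Subsingleton.elim j 0]
    rfl
  rw [this]
  exact h _

theorem two_form_swap {V : Type*} [AddCommGroup V] [Module ℝ V] [TopologicalSpace V]
    (α : V [⋀^Fin 2]→L[ℝ] ℝ) (v w : V) : α ![v, w] = -α ![w, v] := by
  have h := α.toAlternatingMap.map_swap ![w, v] (i := 0) (j := 1) (by simp)
  have e : ![w, v] ∘ Equiv.swap (0 : Fin 2) 1 = ![v, w] := by
    funext j
    fin_cases j <;> simp
  rw [e] at h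
  exact h

theorem exists_eval_eq {F : Type*} [NormedAddCommGroup F] [NormedSpace ℝ F]
    [FiniteDimensional ℝ F] (l : (F →L[ℝ] ℝ) →ₗ[ℝ] ℝ) : ∃ ξ : F, ∀ f, l f = f ξ := by
  let e := (LinearMap.toContinuousLinearMap (𝕜 := ℝ) (E := F) (F' := ℝ))
  obtain ⟨ξ, hξ⟩ := (Module.evalEquiv ℝ F).surjective (l ∘ₗ e.toLinearMap)
  refine ⟨ξ, fun f => ?_⟩
  have h := LinearMap.congr_fun hξ f.toLinearMap
  exact h.symm

/-- The pointwise part of cosymplectic reduction: nondegeneracy of the reduced forms. -/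
theorem cosymplectic_reduction_pointwise {F T U Q : Type*}
    [NormedAddCommGroup F] [NormedSpace ℝ F] [FiniteDimensional ℝ F]
    [NormedAddCommGroup T] [NormedSpace ℝ T]
    [NormedAddCommGroup U] [NormedSpace ℝ U] [NormedAddCommGroup Q] [NormedSpace ℝ Q]
    {Ω : T [⋀^Fin 2]→L[ℝ] ℝ} {η : T [⋀^Fin 1]→L[ℝ] ℝ}
    {Ω' : Q [⋀^Fin 2]→L[ℝ] ℝ} {η' : Q [⋀^Fin 1]→L[ℝ] ℝ}
    {γ : F →L[ℝ] T} {A : T →L[ℝ] (F →L[ℝ] ℝ)} {i : U →L[ℝ] T} {p : U →L[ℝ] Q}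
    (hmom : ∀ ξ v, Ω ![γ ξ, v] = A v ξ)
    (hA : Function.Surjective A) (hi : i.range = A.ker) (hp : Function.Surjective p)
    (hker : ∀ v, p v = 0 ↔ ∃ ξ, γ ξ = i v)
    (hΩ' : ∀ v w, Ω' ![p v, p w] = Ω ![i v, i w]) (hη' : ∀ v, η' ![p v] = η ![i v])
    (h0 : formKer Ω ⊓ formKer η = ⊥) (h1 : Module.finrank ℝ (formKer Ω) = 1) :
    η' ≠ 0 ∧ formKer Ω' ⊓ formKer η' = ⊥ ∧ Module.finrank ℝ (formKer Ω') = 1 := by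
  have hi' : ∀ v, A (i v) = 0 := fun v => by
    have : i v ∈ i.range := ⟨v, rfl⟩
    rw [hi] at this
    exact this
  obtain ⟨R, hR0, hR⟩ := finrank_eq_one_iff'.1 h1
  have hRk : ∀ w, Ω ![R.1, w] = 0 := mem_formKer_two.1 R.2
  have hηR : η ![R.1] ≠ 0 := fun h => hR0 (Subtype.ext (by
    have : R.1 ∈ formKer Ω ⊓ formKer η := ⟨R.2, mem_formKer_one.2 h⟩
    rwa [h0] at this))
  -- The vector `R` spanning `ker Ω` is tangent to the level set: `A R ξ = Ω(γ ξ, R) = 0`.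
  have hAR : R.1 ∈ A.ker := by
    refine LinearMap.mem_ker.2 (ContinuousLinearMap.ext fun ξ => ?_)
    change A R.1 ξ = 0
    rw [← hmom, two_form_swap, hRk, neg_zero]
  obtain ⟨r, hr⟩ : R.1 ∈ i.range := by rw [hi]; exact hAR
  change i r = R.1 at hr
  have hη'r : η' ![p r] ≠ 0 := by rwa [hη', hr]
  have hrk : p r ∈ formKer Ω' := mem_formKer_two.2 fun w => by
    obtain ⟨v, rfl⟩ := hp w
    rw [hΩ', hr, hRk]
  -- If `p v` is in the kernel, `Ω(i v, ·)` vanishes on `ker A`, so it factors through `A` and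
  -- equals `A(·) ξ = Ω(γ ξ, ·)` for some `ξ`. Then `i v - γ ξ` is a multiple `c • R`, and `p` kills
  -- `v - c • r`.
  have key : ∀ q ∈ formKer Ω', ∃ c : ℝ, c • p r = q := by
    intro q hq
    obtain ⟨v, rfl⟩ := hp q
    have hv : ∀ w, Ω ![i v, i w] = 0 := fun w => by
      rw [← hΩ']; exact mem_formKer_two.1 hq _
    let L : T →L[ℝ] ℝ := Ω.toContinuousMultilinearMap.toContinuousLinearMap ![i v, 0] 1
    have hL : ∀ w, L w = Ω ![i v, w] := fun w => by
      change Ω (Function.update ![i v, 0] 1 w) = _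
      congr 1
      funext j
      fin_cases j <;> simp
    have hL0 : ∀ w, A w = 0 → L w = 0 := fun w hw => by
      obtain ⟨w', hw'⟩ : w ∈ i.range := by rw [hi]; exact hw
      rw [hL, ← hw']
      exact hv w'
    obtain ⟨B, hB⟩ := A.toLinearMap.exists_rightInverse_of_surjective (LinearMap.range_eq_top.2 hA)
    -- Finite-dimensional biduality turns a functional on `𝔤^*` into evaluation at an element of
    -- `𝔤`.
    obtain ⟨ξ, hξ⟩ := exists_eval_eq (L.toLinearMap ∘ₗ B)
    have hLξ : ∀ w, Ω ![i v, w] = Ω ![γ ξ, w] := fun w => by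
      have e1 : A (w - B (A w)) = 0 := by
        rw [map_sub, sub_eq_zero]
        exact (LinearMap.congr_fun hB (A w)).symm
      have e2 := hL0 _ e1
      rw [map_sub, sub_eq_zero] at e2
      rw [hmom, ← hξ, ← hL, e2]
      rfl
    have hmem : i v - γ ξ ∈ formKer Ω := mem_formKer_two.2 fun w => by
      have : Ω ![i v - γ ξ, w] = Ω ![i v, w] - Ω ![γ ξ, w] := by
        have h := ContinuousAlternatingMap.vecCons_add Ω (m := ![w]) (i v - γ ξ) (γ ξ)
        rw [sub_add_cancel] at h
        exact (sub_eq_iff_eq_add.2 h).symm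
      rw [this, hLξ, sub_self]
    obtain ⟨c, hc⟩ := hR ⟨_, hmem⟩
    have hc' : c • R.1 = i v - γ ξ := congrArg Subtype.val hc
    have e3 : p (v - c • r) = 0 := (hker _).2 ⟨ξ, by
      rw [map_sub, map_smul, hr, hc', sub_sub_cancel]⟩
    rw [map_sub, map_smul, sub_eq_zero] at e3
    exact ⟨c, e3.symm⟩
  have hpr : p r ≠ 0 := fun h => hη'r (by
    rw [h]
    exact η'.map_coord_zero 0 rfl)
  refine ⟨fun h => hη'r (by rw [h]; rfl), ?_, ?_⟩
  · refine (Submodule.eq_bot_iff _).2 fun q hq => ?_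
    obtain ⟨c, rfl⟩ := key q hq.1
    have h2 := mem_formKer_one.1 hq.2
    have h3 : η' ![c • p r] = c • η' ![p r] := ContinuousAlternatingMap.vecCons_smul η' ![] c (p r)
    rw [h3, smul_eq_zero] at h2
    rcases h2 with h2 | h2
    · rw [h2, zero_smul]
    · exact absurd h2 hη'r
  · refine finrank_eq_one_iff'.2 ⟨⟨p r, hrk⟩, fun h => hpr (congrArg Subtype.val h), fun q => ?_⟩
    obtain ⟨c, hc⟩ := key q.1 q.2
    exact ⟨c, Subtype.ext hc⟩

end Pointwise

/-! ### The projection as a submersion, and reduced forms in charts -/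

section Projection

variable {E : Type*} [NormedAddCommGroup E] [NormedSpace ℝ E]
  {M : Type*} [TopologicalSpace M] [ChartedSpace E M]
  {F : Type*} [NormedAddCommGroup F] [NormedSpace ℝ F]
  {G : Type*} [TopologicalSpace G] [ChartedSpace F G] [Group G] [LieGroup 𝓘(ℝ, F) ∞ G]
  [MulAction G M] [ContMDiffSMul 𝓘(ℝ, F) 𝓘(ℝ, E) ∞ G M] [ContinuousConstSMul G M]
  {J : M → F →L[ℝ] ℝ} {μ : F →L[ℝ] ℝ} {k d : ℕ}
  (hJ : ∀ (g : G) (x : M), J (g • x) = Coad g (J x))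
  (a : ∀ x : J ⁻¹' {μ}, AdaptedChart E G J μ k d x.1)

/-- In the charts induced by one adapted chart the projection is `(b, c) ↦ c`. -/
theorem isSubmersion_reducedProj :
    letI := levelChartedSpace a
    letI := reducedChartedSpace hJ a
    Manifold.IsSubmersion 𝓘(ℝ, EuclideanSpace ℝ (Fin (k + d))) 𝓘(ℝ, EuclideanSpace ℝ (Fin d)) ∞
      (reducedProj G J μ) := by
  let _ := levelChartedSpace a
  let _ := reducedChartedSpace hJ a
  have := isManifold_level a
  have := isManifold_reduced hJ a
  refine ⟨EuclideanSpace ℝ (Fin k), inferInstance, inferInstance, fun x => ?_⟩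
  refine Manifold.IsSubmersionAtOfComplement.mk_of_charts
    ((splitting k d).trans (ContinuousLinearEquiv.prodComm ℝ _ _)) ((a x).levelChart x.2)
    ((a x).redChart x.2 hJ) (a x).mem_source ⟨x, (a x).mem_source, rfl⟩
    (IsManifold.chart_mem_maximalAtlas x) (IsManifold.subset_maximalAtlas ⟨x, rfl⟩) ?_ ?_
  · exact fun y hy => ⟨y, hy, rfl⟩
  · intro u hu
    have hu' : u ∈ ((a x).levelChart x.2).target := by simpa using hu
    have hu'' : ((0, splitting k d u) : Coords F k d) ∈ (a x).Φ.target := hu'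
    change (a x).redFun (reducedProj G J μ (((a x).levelChart x.2).symm u)) = (splitting k d u).2
    rw [(a x).redFun_reducedProj hJ (((a x).levelChart x.2).map_target hu'),
      (a x).levelChart_symm_val x.2 hu', (a x).Φ.right_inv hu'']

theorem mdifferentiableAt_reducedProj (x : J ⁻¹' {μ}) :
    letI := levelChartedSpace a
    letI := reducedChartedSpace hJ a
    MDifferentiableAt 𝓘(ℝ, EuclideanSpace ℝ (Fin (k + d))) 𝓘(ℝ, EuclideanSpace ℝ (Fin d))
      (reducedProj G J μ) x := by
  let _ := levelChartedSpace a
  let _ := reducedChartedSpace hJ a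
  have := isManifold_level a
  have := isManifold_reduced hJ a
  exact ((isSubmersion_reducedProj hJ a).contMDiff x).mdifferentiableAt (by simp)

/-- Up to an isomorphism, the differential of the projection is that of the last component of an
adapted chart. -/
theorem exists_comp_tmap_reducedProj (x : J ⁻¹' {μ}) :
    letI := levelChartedSpace a
    letI := reducedChartedSpace hJ a
    ∃ C : EuclideanSpace ℝ (Fin d) →L[ℝ] EuclideanSpace ℝ (Fin d), Function.Bijective C ∧
      C.comp (tmap (EuclideanSpace ℝ (Fin (k + d))) (EuclideanSpace ℝ (Fin d))
        (reducedProj G J μ) x) =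
      tmap (EuclideanSpace ℝ (Fin (k + d))) (EuclideanSpace ℝ (Fin d))
        (fun y : J ⁻¹' {μ} => ((a x).Φ y).2.2) x := by
  let _ := levelChartedSpace a
  let _ := reducedChartedSpace hJ a
  have := isManifold_level a
  have := isManifold_reduced hJ a
  set V := EuclideanSpace ℝ (Fin (k + d))
  set W := EuclideanSpace ℝ (Fin d)
  have hχ : ((a x).redChart x.2 hJ).MDifferentiable 𝓘(ℝ, W) 𝓘(ℝ, W) :=
    mdifferentiable_of_mem_atlas ⟨x, rfl⟩
  have hx : reducedProj G J μ x ∈ ((a x).redChart x.2 hJ).source := ⟨x, (a x).mem_source, rfl⟩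
  refine ⟨tmap W W ((a x).redChart x.2 hJ) (reducedProj G J μ x), hχ.mfderiv_bijective hx, ?_⟩
  rw [← tmap_comp rfl (hχ.mdifferentiableAt hx) (mdifferentiableAt_reducedProj hJ a x)]
  refine tmap_congr ?_
  filter_upwards [((a x).levelChart x.2).open_source.mem_nhds (a x).mem_source] with y hy
  exact (a x).redFun_reducedProj hJ hy

theorem surjective_tmap_reducedProj (x : J ⁻¹' {μ}) :
    letI := levelChartedSpace a
    letI := reducedChartedSpace hJ a
    Function.Surjective (tmap (EuclideanSpace ℝ (Fin (k + d))) (EuclideanSpace ℝ (Fin d))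
        (reducedProj G J μ) x) := by
  let _ := levelChartedSpace a
  let _ := reducedChartedSpace hJ a
  have := isManifold_level a
  set V := EuclideanSpace ℝ (Fin (k + d))
  set W := EuclideanSpace ℝ (Fin d)
  obtain ⟨C, hC, h⟩ := exists_comp_tmap_reducedProj hJ a x
  have hχ : ((a x).levelChart x.2).MDifferentiable 𝓘(ℝ, V) 𝓘(ℝ, V) :=
    mdifferentiable_of_mem_atlas ⟨x, rfl⟩
  let P : V →L[ℝ] W := (ContinuousLinearMap.snd ℝ _ _).comp
    (splitting k d : V →L[ℝ] EuclideanSpace ℝ (Fin k) × W)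
  have h1 : tmap V W (fun y : J ⁻¹' {μ} => ((a x).Φ y).2.2) x =
      P.comp (tmap V V ((a x).levelChart x.2) x) := by
    rw [← tmap_hasFDerivAt_comp P.hasFDerivAt (hχ.mdifferentiableAt (a x).mem_source)]
    congr 1
    funext y
    change _ = (splitting k d ((splitting k d).symm ((a x).Φ y).2)).2
    rw [ContinuousLinearEquiv.apply_symm_apply]
  have h2 : Function.Surjective P := Prod.snd_surjective.comp (splitting k d).surjective
  have h3 : Function.Surjective (tmap V V ((a x).levelChart x.2) x) :=
    hχ.mfderiv_surjective (a x).mem_source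
  intro w
  obtain ⟨v, hv⟩ := (h2.comp h3) (C w)
  refine ⟨v, hC.1 ?_⟩
  rw [← hv]
  exact congrArg (fun l : V →L[ℝ] W => l v) (h.trans h1)

/-- The vertical directions are those of the orbits; this is the field `ker` of an adapted chart,
carried to the quotient by the isomorphism `C`. -/
theorem tmap_reducedProj_eq_zero_iff (x : J ⁻¹' {μ}) :
    letI := levelChartedSpace a
    letI := reducedChartedSpace hJ a
    ∀ v : EuclideanSpace ℝ (Fin (k + d)),
    tmap (EuclideanSpace ℝ (Fin (k + d))) E (Subtype.val : J ⁻¹' {μ} → M) x v ∈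
      (tmap E (F →L[ℝ] ℝ) J x).ker →
    (tmap (EuclideanSpace ℝ (Fin (k + d))) (EuclideanSpace ℝ (Fin d)) (reducedProj G J μ) x v = 0 ↔
      ∃ ξ : F, tmap F E (fun g : G => g • (x : M)) 1 ξ =
        tmap (EuclideanSpace ℝ (Fin (k + d))) E (Subtype.val : J ⁻¹' {μ} → M) x v) := by
  let _ := levelChartedSpace a
  let _ := reducedChartedSpace hJ a
  have := isManifold_level a
  set V := EuclideanSpace ℝ (Fin (k + d))
  set W := EuclideanSpace ℝ (Fin d)
  intro v hv
  obtain ⟨C, hC, h⟩ := exists_comp_tmap_reducedProj hJ a x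
  rw [← (a x).ker x (a x).mem_source x.2 _ hv]
  let P : Coords F k d →L[ℝ] W :=
    (ContinuousLinearMap.snd ℝ _ _).comp (ContinuousLinearMap.snd ℝ _ _)
  have hd : MDifferentiableAt 𝓘(ℝ, V) 𝓘(ℝ, E) (Subtype.val : J ⁻¹' {μ} → M) x :=
    (contMDiff_level_val a x).mdifferentiableAt (by simp)
  have hΦ := (a x).mdifferentiable.mdifferentiableAt (a x).mem_source
  have h1 : tmap V W (fun y : J ⁻¹' {μ} => ((a x).Φ y).2.2) x = P.comp
      ((tmap E (Coords F k d) (a x).Φ x).comp (tmap V E (Subtype.val : J ⁻¹' {μ} → M) x)) := by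
    rw [← tmap_comp rfl hΦ hd]
    exact tmap_hasFDerivAt_comp (f := fun y : J ⁻¹' {μ} => (a x).Φ y) P.hasFDerivAt (hΦ.comp x hd)
  have h2 := congrArg (fun l : V →L[ℝ] W => l v) (h.trans h1)
  exact (map_eq_zero_iff C hC.1).symm.trans (Iff.of_eq (congrArg (· = 0) h2))

/-- A form on the reduced space whose pullback to the level set is the restriction of a smooth
form is smooth, and it is closed if that form is. -/
theorem isSmooth_isClosed_of_pullback_eq [IsManifold 𝓘(ℝ, E) ∞ M] {n : ℕ}
    {α : DiffForm E M n} (hα : α.IsSmooth) (hα' : α.IsClosed) :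
    letI := levelChartedSpace a
    letI := reducedChartedSpace hJ a
    ∀ β : DiffForm (EuclideanSpace ℝ (Fin d)) (ReducedSpace G J μ) n,
      DiffForm.pullback (E := EuclideanSpace ℝ (Fin (k + d))) (reducedProj G J μ) β =
        DiffForm.pullback (Subtype.val : J ⁻¹' {μ} → M) α → β.IsSmooth ∧ β.IsClosed := by
  let _ := levelChartedSpace a
  let _ := reducedChartedSpace hJ a
  have := isManifold_level a
  have := isManifold_reduced hJ a
  set V := EuclideanSpace ℝ (Fin (k + d))
  set W := EuclideanSpace ℝ (Fin d)
  intro β hβ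
  -- The inverse of a chart of `M_μ` is the projection after the local section, so the coordinate
  -- expression of `β` is the pullback of `α` by that section viewed in `M`.
  have key : ∀ z : ReducedSpace G J μ, IsOpen (extChartAt 𝓘(ℝ, W) z).target ∧
      ContMDiffOn 𝓘(ℝ, W) 𝓘(ℝ, E) ∞ (fun c => ((a z.out).section' z.out.2 c : M))
        (extChartAt 𝓘(ℝ, W) z).target ∧
      Set.EqOn (β.inChart z) (modelPullback (fun c => ((a z.out).section' z.out.2 c : M)) α)
        (extChartAt 𝓘(ℝ, W) z).target := by
    intro z
    have ht : (extChartAt 𝓘(ℝ, W) z).target =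
        {c | ((0, 0, c) : Coords F k d) ∈ (a z.out).Φ.target} := by
      simp [extChartAt]
      rfl
    have hs := (a z.out).contMDiffOn_section z.out.2
    rw [← ht] at hs
    have ho : IsOpen (extChartAt 𝓘(ℝ, W) z).target := isOpen_extChartAt_target z
    refine ⟨ho, hs, fun c hc => ?_⟩
    have hs1 : MDifferentiableAt 𝓘(ℝ, W) 𝓘(ℝ, V) ((a z.out).section' z.out.2) c :=
      (contMDiffAt_level a (hs.contMDiffAt (ho.mem_nhds hc))).mdifferentiableAt (by simp)
    have h1 := pullback_comp β (mdifferentiableAt_reducedProj hJ a _) hs1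
    have h2 := pullback_comp α ((contMDiff_level_val a _).mdifferentiableAt (by simp)) hs1
    rw [hβ, ← h2] at h1
    exact h1
  refine ⟨fun z => ?_, fun z c hc => ?_⟩
  · obtain ⟨ho, hs, he⟩ := key z
    exact (contDiffOn_pullback ho hs hα).congr he
  · obtain ⟨ho, hs, he⟩ := key z
    have h1 := (he.eventuallyEq_of_mem (ho.mem_nhds hc)).extDeriv_eq (𝕜 := ℝ)
    exact h1.trans (extDeriv_pullback_eq_zero ho hs hα hα' hc)

end Projection

/-! ### Descent of invariant forms to the reduced space -/

section ReducedForm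

variable {E : Type*} [NormedAddCommGroup E] [NormedSpace ℝ E]
  {M : Type*} [TopologicalSpace M] [ChartedSpace E M]
  {F : Type*} [NormedAddCommGroup F] [NormedSpace ℝ F]
  {G : Type*} [TopologicalSpace G] [ChartedSpace F G] [Group G] [LieGroup 𝓘(ℝ, F) ∞ G]
  [MulAction G M] [ContMDiffSMul 𝓘(ℝ, F) 𝓘(ℝ, E) ∞ G M] [ContinuousConstSMul G M]
  {J : M → F →L[ℝ] ℝ} {μ : F →L[ℝ] ℝ} {k d : ℕ}
  (hJ : ∀ (g : G) (x : M), J (g • x) = Coad g (J x))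
  (a : ∀ x : J ⁻¹' {μ}, AdaptedChart E G J μ k d x.1)

/-- An invariant form whose restriction to the level set annihilates the directions of the orbits
descends to the reduced space. -/
theorem exists_pullback_reducedProj_eq {n : ℕ} {α : DiffForm E M (n + 1)}
    (hinv : ∀ g : G, DiffForm.pullback (fun x : M => g • x) α = α) :
    letI := levelChartedSpace a
    letI := reducedChartedSpace hJ a
    (∀ x : J ⁻¹' {μ}, (tmap (EuclideanSpace ℝ (Fin (k + d))) E (Subtype.val : J ⁻¹' {μ} → M) x).range
      = (tmap E (F →L[ℝ] ℝ) J x).ker) →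
    (∀ (x : J ⁻¹' {μ}) (ξ : F), ∀ w : Fin n → E, (∀ i, w i ∈ (tmap E (F →L[ℝ] ℝ) J x).ker) →
      (α x : E [⋀^Fin (n + 1)]→L[ℝ] ℝ)
        (Matrix.vecCons (tmap F E (fun g : G => g • (x : M)) 1 ξ) w) = 0) →
    ∃ β : DiffForm (EuclideanSpace ℝ (Fin d)) (ReducedSpace G J μ) (n + 1),
      DiffForm.pullback (E := EuclideanSpace ℝ (Fin (k + d))) (reducedProj G J μ) β =
        DiffForm.pullback (Subtype.val : J ⁻¹' {μ} → M) α := by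
  let _ := levelChartedSpace a
  let _ := reducedChartedSpace hJ a
  intro hrange hbasic
  refine exists_pullback_eq (p := reducedProj G J μ) Quotient.mk_surjective (surjective_tmap_reducedProj hJ a) _ ?_
  intro x x' hx v v' hv
  obtain ⟨g, hg⟩ := (reducedProj_eq_iff hJ x x').1 hx
  have hgμ : g ∈ isotropy G μ := mem_isotropy_of_smul_mem hJ x.2 (by rw [hg]; exact x'.2)
  -- Translation by `g` moves `x` to `x'` and commutes with the projection, so both vectors can be
  -- compared at `x'`.
  let σ : J ⁻¹' {μ} → J ⁻¹' {μ} := fun y => ⟨g • y.1, smul_mem_level hJ hgμ y.2⟩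
  have hval : ∀ y : J ⁻¹' {μ}, MDifferentiableAt 𝓘(ℝ, EuclideanSpace ℝ (Fin (k + d))) 𝓘(ℝ, E)
      (Subtype.val : J ⁻¹' {μ} → M) y := fun y =>
    (contMDiff_level_val a y).mdifferentiableAt (by simp)
  have hgd : MDifferentiableAt 𝓘(ℝ, E) 𝓘(ℝ, E) (fun y : M => g • y) x :=
    (ContMDiffSMul.contMDiff_const_smul (I := 𝓘(ℝ, F)) (n := ∞) g).mdifferentiableAt (by simp)
  have hσ : MDifferentiableAt 𝓘(ℝ, EuclideanSpace ℝ (Fin (k + d)))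
      𝓘(ℝ, EuclideanSpace ℝ (Fin (k + d))) σ x := by
    refine (contMDiffAt_level a (f := σ) ?_).mdifferentiableAt (by simp)
    exact (ContMDiffSMul.contMDiff_const_smul (I := 𝓘(ℝ, F)) (n := ∞) g).contMDiffAt.comp x
      (contMDiff_level_val a x)
  obtain rfl : σ x = x' := Subtype.ext hg
  have hπ : (fun y => reducedProj G J μ (σ y)) = reducedProj G J μ :=
    funext fun y => ((reducedProj_eq_iff hJ _ _).2 ⟨g, rfl⟩).symm
  have h1 := tmap_comp rfl (mdifferentiableAt_reducedProj hJ a (σ x)) hσ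
  rw [hπ] at h1
  have h2 : (DiffForm.pullback (Subtype.val : J ⁻¹' {μ} → M) α (σ x) :
      EuclideanSpace ℝ (Fin (k + d)) [⋀^Fin (n + 1)]→L[ℝ] ℝ) v' =
      (DiffForm.pullback (Subtype.val : J ⁻¹' {μ} → M) α (σ x) :
      EuclideanSpace ℝ (Fin (k + d)) [⋀^Fin (n + 1)]→L[ℝ] ℝ)
        (fun i => tmap (EuclideanSpace ℝ (Fin (k + d))) (EuclideanSpace ℝ (Fin (k + d))) σ x (v i)) := by
    -- The vectors `v' i` and the translate of `v i` have the same projection, so they differ by an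
    -- orbit direction, which the restricted form annihilates.
    refine apply_eq_of_sub_mem_formKer fun i => ?_
    set u := v' i - tmap (EuclideanSpace ℝ (Fin (k + d))) (EuclideanSpace ℝ (Fin (k + d))) σ x (v i)
      with hu
    have h3 : tmap (EuclideanSpace ℝ (Fin (k + d))) (EuclideanSpace ℝ (Fin d))
        (reducedProj G J μ) (σ x) u = 0 := by
      rw [hu, map_sub, ← hv i, h1, sub_eq_zero]
      rfl
    have hk : ∀ w, tmap (EuclideanSpace ℝ (Fin (k + d))) E (Subtype.val : J ⁻¹' {μ} → M) (σ x) w ∈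
        (tmap E (F →L[ℝ] ℝ) J (σ x)).ker := fun w => by
      rw [← hrange]; exact ⟨w, rfl⟩
    obtain ⟨ξ, hξ⟩ := (tmap_reducedProj_eq_zero_iff hJ a (σ x) u (hk u)).1 h3
    refine mem_formKer.2 fun w => ?_
    refine (pullback_apply (V := EuclideanSpace ℝ (Fin (k + d))) _ α (σ x) _).trans ?_
    have h4 := hbasic (σ x) ξ _ fun i => hk (w i)
    rw [hξ] at h4
    refine Eq.trans (congrArg _ ?_) h4
    funext j
    exact Fin.cases rfl (fun _ => rfl) j
  rw [h2]
  have h5 := pullback_comp α (hval (σ x)) hσ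
  have h6 := pullback_comp α hgd (hval x)
  rw [hinv] at h6
  have h7 := h6.symm.trans h5
  exact congrArg (fun l : EuclideanSpace ℝ (Fin (k + d)) [⋀^Fin (n + 1)]→L[ℝ] ℝ => l v) h7

end ReducedForm

/-! ### Dimension counts and the moment identity -/

section Dimension

theorem finrank_ker_inf_range {A B C : Type*} [NormedAddCommGroup A] [NormedSpace ℝ A]
    [NormedAddCommGroup B] [NormedSpace ℝ B] [NormedAddCommGroup C] [NormedSpace ℝ C]
    (f : B →L[ℝ] C) (g : A →L[ℝ] B) (hg : Function.Injective g) :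
    Module.finrank ℝ (f.ker ⊓ g.range : Submodule ℝ B) = Module.finrank ℝ (f.comp g).ker := by
  have h : (f.ker ⊓ g.range : Submodule ℝ B) = Submodule.map g.toLinearMap (f.comp g).ker := by
    rw [inf_comm]
    exact (Submodule.map_comap_eq g.toLinearMap f.ker).symm
  rw [h]
  exact (LinearEquiv.finrank_eq (Submodule.equivMapOfInjective g.toLinearMap hg _)).symm

variable {E : Type*} [NormedAddCommGroup E] [NormedSpace ℝ E]
  {M : Type*} [TopologicalSpace M] [ChartedSpace E M]
  {F : Type*} [NormedAddCommGroup F] [NormedSpace ℝ F]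
  {G : Type*} [TopologicalSpace G] [ChartedSpace F G] [Group G]
  [MulAction G M] {J : M → F →L[ℝ] ℝ}

/-- Differentiating the equivariance at `g = 1` shows that `dJ` on orbit directions depends on `x`
only through `J x`; this makes the rank constant on `J⁻¹(μ)`. -/
theorem tmap_comp_orbit [ContMDiffSMul 𝓘(ℝ, F) 𝓘(ℝ, E) ∞ G M]
    (hJs : ContMDiff 𝓘(ℝ, E) 𝓘(ℝ, F →L[ℝ] ℝ) ∞ J)
    (hJ : ∀ (g : G) (x : M), J (g • x) = Coad g (J x)) (x : M) :
    (tmap E (F →L[ℝ] ℝ) J x).comp (tmap F E (fun g : G => g • x) 1) =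
      tmap F (F →L[ℝ] ℝ) (fun g : G => Coad g (J x)) 1 := by
  rw [← tmap_comp (f := fun g : G => g • x) (one_smul G x) ((hJs x).mdifferentiableAt (by simp))
    ((contMDiff_smul_const E F x 1).mdifferentiableAt (by simp))]
  congr 1
  funext g
  exact hJ g x

theorem IsMomentumMap.apply_orbit {Ω : DiffForm E M 2} (hJ : IsMomentumMap G Ω J) (ξ : F) (x : M)
    (v : E) : (Ω x : E [⋀^Fin 2]→L[ℝ] ℝ) ![tmap F E (fun g : G => g • x) 1 ξ, v] =
      tmap E (F →L[ℝ] ℝ) J x v ξ := by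
  refine (hJ.moment ξ x v).trans ?_
  have h := tmap_hasFDerivAt_comp (g := fun f : F →L[ℝ] ℝ => f ξ)
    (ContinuousLinearMap.apply ℝ ℝ ξ).hasFDerivAt ((hJ.smooth x).mdifferentiableAt (by simp))
  exact congrArg (fun l : E →L[ℝ] ℝ => l v) h

/-- The infinitesimal action is injective at regular points of a momentum map. -/
theorem IsMomentumMap.injective_orbit [FiniteDimensional ℝ F] {Ω : DiffForm E M 2}
    (hJ : IsMomentumMap G Ω J) {x : M} (hx : Function.Surjective (tmap E (F →L[ℝ] ℝ) J x)) :
    Function.Injective (tmap F E (fun g : G => g • x) 1) := by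
  refine (injective_iff_map_eq_zero _).2 fun ξ hξ => ?_
  refine (Module.forall_dual_apply_eq_zero_iff ℝ ξ).1 fun f => ?_
  obtain ⟨v, hv⟩ := hx (LinearMap.toContinuousLinearMap f)
  have h := hJ.apply_orbit ξ x v
  rw [hξ, hv] at h
  exact h.symm.trans (ContinuousAlternatingMap.map_coord_zero (Ω x : E [⋀^Fin 2]→L[ℝ] ℝ) 0 rfl)

end Dimension

end CosymplecticReduction

end

/-! ### Assembly of the reduction theorem -/

open CosymplecticReduction in
theorem mainTheorem7
    {E : Type*} [NormedAddCommGroup E] [NormedSpace ℝ E] [FiniteDimensional ℝ E]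
    {M : Type*} [TopologicalSpace M] [T2Space M] [SecondCountableTopology M]
    [ChartedSpace E M] [IsManifold 𝓘(ℝ, E) ∞ M]
    {F : Type*} [NormedAddCommGroup F] [NormedSpace ℝ F] [FiniteDimensional ℝ F]
    {G : Type*} [TopologicalSpace G] [T2Space G] [SecondCountableTopology G] [ConnectedSpace G]
    [ChartedSpace F G] [Group G] [LieGroup 𝓘(ℝ, F) ∞ G]
    [MulAction G M] [ContMDiffSMul 𝓘(ℝ, F) 𝓘(ℝ, E) ∞ G M]
    (hfree : ∀ (g : G) (x : M), g • x = x → g = 1) (hproper : ProperSMul G M)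
    (Ω : CosymplecticReduction.DiffForm E M 2) (η : CosymplecticReduction.DiffForm E M 1)
    (hM : CosymplecticReduction.IsCosymplectic Ω η)
    (hact : CosymplecticReduction.IsCosymplecticAction F G Ω η)
    (J : M → F →L[ℝ] ℝ) (hJ : CosymplecticReduction.IsMomentumMap G Ω J)
    (μ : F →L[ℝ] ℝ) (hμ : CosymplecticReduction.IsRegularValue (E := E) J μ) :
    T2Space (CosymplecticReduction.ReducedSpace G J μ) ∧
    SecondCountableTopology (CosymplecticReduction.ReducedSpace G J μ) ∧
    ∃ (m d : ℕ)
      (_ : ChartedSpace (EuclideanSpace ℝ (Fin m)) (J ⁻¹' {μ}))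
      (_ : ChartedSpace (EuclideanSpace ℝ (Fin d)) (CosymplecticReduction.ReducedSpace G J μ)),
      -- `J⁻¹(μ)` is an embedded submanifold of `M`
      IsManifold 𝓘(ℝ, EuclideanSpace ℝ (Fin m)) ∞ (J ⁻¹' {μ}) ∧
      Manifold.IsSmoothEmbedding 𝓘(ℝ, EuclideanSpace ℝ (Fin m)) 𝓘(ℝ, E) ∞
        (Subtype.val : J ⁻¹' {μ} → M) ∧
      -- `M_μ` is the quotient manifold, that is, the projection is a submersion
      IsManifold 𝓘(ℝ, EuclideanSpace ℝ (Fin d)) ∞ (CosymplecticReduction.ReducedSpace G J μ) ∧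
      Manifold.IsSubmersion 𝓘(ℝ, EuclideanSpace ℝ (Fin m)) 𝓘(ℝ, EuclideanSpace ℝ (Fin d)) ∞
        (CosymplecticReduction.reducedProj G J μ) ∧
      -- existence of the reduced cosymplectic structure, and uniqueness among all forms
      ∃ (Ωμ : CosymplecticReduction.DiffForm (EuclideanSpace ℝ (Fin d))
            (CosymplecticReduction.ReducedSpace G J μ) 2)
        (ημ : CosymplecticReduction.DiffForm (EuclideanSpace ℝ (Fin d))
            (CosymplecticReduction.ReducedSpace G J μ) 1),
        CosymplecticReduction.IsCosymplectic Ωμ ημ ∧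
        (CosymplecticReduction.DiffForm.pullback (E := EuclideanSpace ℝ (Fin m))
            (CosymplecticReduction.reducedProj G J μ) Ωμ =
          CosymplecticReduction.DiffForm.pullback (Subtype.val : J ⁻¹' {μ} → M) Ω) ∧
        (CosymplecticReduction.DiffForm.pullback (E := EuclideanSpace ℝ (Fin m))
            (CosymplecticReduction.reducedProj G J μ) ημ =
          CosymplecticReduction.DiffForm.pullback (Subtype.val : J ⁻¹' {μ} → M) η) ∧
        (∀ Ω' : CosymplecticReduction.DiffForm (EuclideanSpace ℝ (Fin d))
            (CosymplecticReduction.ReducedSpace G J μ) 2,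
          CosymplecticReduction.DiffForm.pullback (E := EuclideanSpace ℝ (Fin m))
              (CosymplecticReduction.reducedProj G J μ) Ω' =
            CosymplecticReduction.DiffForm.pullback (Subtype.val : J ⁻¹' {μ} → M) Ω →
          Ω' = Ωμ) ∧
        (∀ η' : CosymplecticReduction.DiffForm (EuclideanSpace ℝ (Fin d))
            (CosymplecticReduction.ReducedSpace G J μ) 1,
          CosymplecticReduction.DiffForm.pullback (E := EuclideanSpace ℝ (Fin m))
              (CosymplecticReduction.reducedProj G J μ) η' =
            CosymplecticReduction.DiffForm.pullback (Subtype.val : J ⁻¹' {μ} → M) η →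
          η' = ημ) := by
  have := hproper
  have : IsTopologicalGroup G := topologicalGroup_of_lieGroup 𝓘(ℝ, F) ∞
  have : ContinuousSMul G M := ContMDiffSMul.continuousSMul (I := 𝓘(ℝ, F)) (I' := 𝓘(ℝ, E)) ∞
  have hJe := hJ.equivariant
  have hsurj : ∀ y : M, J y = μ → Function.Surjective (tmap E (F →L[ℝ] ℝ) J y) := fun y hy => hμ y hy
  have hinj : ∀ y : M, J y = μ → Function.Injective (tmap F E (fun g : G => g • y) 1) :=
    fun y hy => hJ.injective_orbit (hsurj y hy)
  -- The dimension of orbit directions tangent to the level set, expressed through `μ` alone and so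
  -- the same at every point.
  set k := Module.finrank ℝ (tmap F (F →L[ℝ] ℝ) (fun g : G => Coad g μ) 1).ker with hk_def
  have hk : ∀ y : M, J y = μ → Module.finrank ℝ ((tmap E (F →L[ℝ] ℝ) J y).ker ⊓
      (tmap F E (fun g : G => g • y) 1).range : Submodule ℝ E) = k := fun y hy => by
    rw [finrank_ker_inf_range _ _ (hinj y hy), tmap_comp_orbit hJ.smooth hJe, hy]
  obtain ⟨d, hd⟩ : ∃ d, ∀ y : M, J y = μ → Module.finrank ℝ E = Module.finrank ℝ F + k + d := by
    -- The subtraction is exact as soon as the level set has a point: there `dJ` is onto and its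
    -- kernel has dimension at least `k`. For an empty level set the value is irrelevant.
    refine ⟨Module.finrank ℝ E - Module.finrank ℝ F - k, fun y hy => ?_⟩
    have h1 := LinearMap.finrank_range_add_finrank_ker (tmap E (F →L[ℝ] ℝ) J y).toLinearMap
    rw [LinearMap.range_eq_top.2 (hsurj y hy), finrank_top, finrank_continuousDual] at h1
    have h2 : k ≤ Module.finrank ℝ (tmap E (F →L[ℝ] ℝ) J y).toLinearMap.ker := by
      rw [← hk y hy]
      exact Submodule.finrank_mono inf_le_left
    omega
  have a : ∀ x : J ⁻¹' {μ}, AdaptedChart E G J μ k d x.1 := fun x =>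
    (exists_adaptedChart hfree hJ.smooth hsurj hinj hk (hd x x.2) x.2).some
  have hq := isOpenQuotientMap_reducedProj (μ := μ) hJe
  let _ := levelChartedSpace a
  let _ := reducedChartedSpace hJe a
  have hrange : ∀ x : J ⁻¹' {μ}, (tmap (EuclideanSpace ℝ (Fin (k + d))) E
      (Subtype.val : J ⁻¹' {μ} → M) x).range = (tmap E (F →L[ℝ] ℝ) J x).ker := fun x =>
    tmap_level_val a hJ.smooth x (hsurj x x.2) (hd x x.2)
  have hηγ : ∀ (ξ : F) (x : M), (η x : E [⋀^Fin 1]→L[ℝ] ℝ)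
      ![tmap F E (fun g : G => g • x) 1 ξ] = 0 := hact.infGen_one
  have hη : ∀ g : G, DiffForm.pullback (fun x : M => g • x) η = η := fun g => by
    funext x
    refine ContinuousAlternatingMap.ext fun v => ?_
    have h := closed_one_form_invariant F hM.smooth_one hM.closed_one
      (fun ξ x => by rw [← hηγ ξ x]; congr 1; funext j; fin_cases j; rfl) g x (v 0)
    refine Eq.trans ?_ (h.trans ?_)
    · refine congrArg (η (g • x) : E [⋀^Fin 1]→L[ℝ] ℝ) (funext fun j => ?_)
      rw [Subsingleton.elim j 0]
      rfl
    · refine congrArg (η x : E [⋀^Fin 1]→L[ℝ] ℝ) (funext fun j => ?_)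
      rw [Subsingleton.elim j 0]
  -- Orbit directions are `Ω`-orthogonal to the level set, since `Ω(ξ_M, w) = ⟨dJ(w), ξ⟩` and `dJ(w)
  -- = 0`.
  obtain ⟨Ωμ, hΩμ⟩ := exists_pullback_reducedProj_eq hJe a hact.pullback_two hrange
    fun x ξ w hw => by
      have e : w = ![w 0] := funext fun j => by rw [Subsingleton.elim j 0]; rfl
      rw [e]
      exact (hJ.apply_orbit ξ x (w 0)).trans
        (congrArg (fun f : F →L[ℝ] ℝ => f ξ) (LinearMap.mem_ker.1 (hw 0)))
  obtain ⟨ημ, hημ⟩ := exists_pullback_reducedProj_eq hJe a hη hrange fun x ξ w _ => by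
      rw [Subsingleton.elim w ![]]
      exact hηγ ξ x
  have hΩs := isSmooth_isClosed_of_pullback_eq hJe a hM.smooth_two hM.closed_two Ωμ hΩμ
  have hηs := isSmooth_isClosed_of_pullback_eq hJe a hM.smooth_one hM.closed_one ημ hημ
  have hps : Function.Surjective (reducedProj G J μ) := Quotient.mk_surjective
  have hpt : ∀ z : ReducedSpace G J μ, ημ z ≠ 0 ∧ formKer (Ωμ z) ⊓ formKer (ημ z) = ⊥ ∧
      Module.finrank ℝ (formKer (Ωμ z)) = 1 := fun z => by
    obtain ⟨x, rfl⟩ := hps z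
    refine cosymplectic_reduction_pointwise (F := F) (T := E)
      (U := EuclideanSpace ℝ (Fin (k + d))) (Q := EuclideanSpace ℝ (Fin d))
      (Ω := Ω x) (η := η x) (i := tmap (EuclideanSpace ℝ (Fin (k + d))) E Subtype.val x)
      (p := tmap (EuclideanSpace ℝ (Fin (k + d))) (EuclideanSpace ℝ (Fin d)) (reducedProj G J μ) x)
      (fun ξ v => hJ.apply_orbit ξ x v) (hsurj x x.2) (hrange x)
      (surjective_tmap_reducedProj hJe a x)
      (fun v => tmap_reducedProj_eq_zero_iff hJe a x v (by rw [← hrange]; exact ⟨v, rfl⟩))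
      (fun v w => ?_) (fun v => ?_) (hM.ker_inf_ker x) (hM.finrank_ker x)
    · have h := congrArg (fun l : EuclideanSpace ℝ (Fin (k + d)) [⋀^Fin 2]→L[ℝ] ℝ => l ![v, w])
        (congrFun hΩμ x)
      refine Eq.trans (congrArg (Ωμ (reducedProj G J μ x) :
        EuclideanSpace ℝ (Fin d) [⋀^Fin 2]→L[ℝ] ℝ) ?_) (h.trans
        (congrArg (Ω x : E [⋀^Fin 2]→L[ℝ] ℝ) ?_)) <;>
      · funext j
        fin_cases j <;> rfl
    · have h := congrArg (fun l : EuclideanSpace ℝ (Fin (k + d)) [⋀^Fin 1]→L[ℝ] ℝ => l ![v])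
        (congrFun hημ x)
      refine Eq.trans (congrArg (ημ (reducedProj G J μ x) :
        EuclideanSpace ℝ (Fin d) [⋀^Fin 1]→L[ℝ] ℝ) ?_) (h.trans
        (congrArg (η x : E [⋀^Fin 1]→L[ℝ] ℝ) ?_)) <;>
      · funext j
        fin_cases j
        rfl
  exact ⟨t2Space_reducedSpace hJe, hq.isQuotientMap.secondCountableTopology hq.isOpenMap, k + d, d,
    levelChartedSpace a, reducedChartedSpace hJe a, isManifold_level a,
    isSmoothEmbedding_level a fun ⟨x⟩ => hd x x.2, isManifold_reduced hJe a,
    isSubmersion_reducedProj hJe a, Ωμ, ημ,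
    ⟨hΩs.1, hηs.1, hΩs.2, hηs.2, fun z => (hpt z).1, fun z => (hpt z).2.1, fun z => (hpt z).2.2⟩,
    hΩμ, hημ,
    fun Ω' h => pullback_injective hps (surjective_tmap_reducedProj hJe a) (h.trans hΩμ.symm),
    fun η' h => pullback_injective hps (surjective_tmap_reducedProj hJe a) (h.trans hημ.symm)⟩
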